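/- Setting. Consider the toric code on a (finite) cellulation of a closed connected oriented surface of arbitrary genus, with one qubit on each edge, star operators $A_s=\prod_{i\in \mathrm{legs}(s)}\sigma^x_i$, plaquette operators $B_p=\prod_{i\in\partial p}\sigma^z_i$ and Hamiltonian $H=-U\sum_s A_s-J\sum_p B_p$ with $U,J>0$. (An edge that meets a vertex or a face twice is counted twice in these products.) A ground state is a normalised eigenvector of $H$ for its lowest eigenvalue; $|\psi_0\rangle$ denotes the normalised equal-weight superposition $N\sum_c W^z_c|+\cdots+\rangle$ over all (contractible and non-contractible) loop configurations $c$, i.e. all edge sets having an even number of edge ends at every vertex, with $W^z_c=\prod_{i\in c}\sigma^z_i$. A region is a set of edges. Two regions share a border if some star or some plaquette involves edges of both; $n_{RS}$ is the number of plaquettes that involve edges of both $R$ and $S$. A region $R$ is called contractible (and simply connected) if it is nonempty; it is connected, in the sense that any two of its edges can be joined by a path on the dual lattice (from plaquette to plaquette) crossing only edges of $R$; every closed path of lattice edges in $R$ is null-homotopic within $R$ (through plaquettes all of whose edges lie in $R$); and every closed path of the dual lattice crossing only edges of $R$ is null-homotopic on the surface. Statement. Let the set of edges be the disjoint union of $A=A_1\sqcup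 A_2$ and $B=B_1\sqcup B_2$, where $A$, $A_2$ and $B_2$ are contractible, $A_2$ shares no border with $B$, and $B_2$ shares no border with $A$. Then $n_{A_1B_1},n_{A_1A_2},n_{B_1B_2}\ge 1$. Put $$\mu_{\max}=2^{n_{A_1B_1}-1},\qquad \nu_{\max}=2^{n_{A_1A_2}-1},\qquad \tau_{\max}=2^{n_{B_1B_2}-1}.$$ There are families $|e_{\mu\nu}\rangle_{A_1}$, $|g_\nu\rangle_{A_2}$, $|h_\tau\rangle_{B_2}$ ($1\le\mu\le\mu_{\max}$, $1\le\nu\le\nu_{\max}$, $1\le\tau\le\tau_{\max}$), each orthonormal, i.e. $\langle e_{\mu'\nu'}|e_{\mu\nu}\rangle=\delta_{\mu\mu'}\delta_{\nu\nu'}$, $\langle g_{\nu'}|g_\nu\rangle=\delta_{\nu\nu'}$, $\langle h_{\tau'}|h_\tau\rangle=\delta_{\tau\tau'}$, such that for $\psi=\psi_0$, and for every ground state $\psi$ of $H$ (for all $U,J>0$), there is an orthonormal family $|f^{(\psi)}_{\mu\tau}\rangle_{B_1}$, $\langle f^{(\psi)}_{\mu'\tau'}|f^{(\psi)}_{\mu\tau}\rangle=\delta_{\mu\mu'}\delta_{\tau\tau'}$,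 with $$|\psi\rangle=\mu_{\max}^{-1/2}\sum_{\mu=1}^{\mu_{\max}}\Bigl(\nu_{\max}^{-1/2}\sum_{\nu=1}^{\nu_{\max}}|e_{\mu\nu}\rangle_{A_1}|g_\nu\rangle_{A_2}\Bigr)\Bigl(\tau_{\max}^{-1/2}\sum_{\tau=1}^{\tau_{\max}}|f^{(\psi)}_{\mu\tau}\rangle_{B_1}|h_\tau\rangle_{B_2}\Bigr).$$ -/

import Mathlib

noncomputable section

/-- A cellulation of a closed connected oriented surface, given as a combinatorial map: `D` is the
set of darts (oriented edges), `edge` reverses a dart, and `vert` rotates a dart about the vertex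
from which it leaves. Vertices, edges and faces are the cycles of `vert`, `edge` and
`face = vert * edge`. -/
structure SurfaceMap (D : Type*) where
  vert : Equiv.Perm D
  edge : Equiv.Perm D
  edge_edge : ∀ d, edge (edge d) = d
  edge_ne : ∀ d, edge d ≠ d
  connected : MulAction.IsPretransitive (Subgroup.closure {vert, edge}) D

namespace SurfaceMap

variable {D : Type*} (M : SurfaceMap D)

/-- Traverse a dart, then take the next dart of the same face. -/
def face : Equiv.Perm D := M.vert * M.edge

abbrev Vertex : Type _ := Quotient (Equiv.Perm.SameCycle.setoid M.vert)
abbrev Edge : Type _ := Quotient (Equiv.Perm.SameCycle.setoid M.edge)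
abbrev Face : Type _ := Quotient (Equiv.Perm.SameCycle.setoid M.face)

/-- The vertex from which a dart leaves. -/
def vertexOf (d : D) : M.Vertex := Quotient.mk _ d
def edgeOf (d : D) : M.Edge := Quotient.mk _ d
def faceOf (d : D) : M.Face := Quotient.mk _ d

instance [Finite D] : Fintype M.Vertex := Fintype.ofFinite _
instance [Finite D] : Fintype M.Edge := Fintype.ofFinite _
instance [Finite D] : Fintype M.Face := Fintype.ofFinite _

theorem edge_mul_edge : M.edge * M.edge = 1 := Equiv.ext M.edge_edge

/-- The dual cellulation: same edges, vertices and faces exchanged. -/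
def dual : SurfaceMap D where
  vert := M.face
  edge := M.edge
  edge_edge := M.edge_edge
  edge_ne := M.edge_ne
  connected := by
    have h : Subgroup.closure {M.face, M.edge} = Subgroup.closure {M.vert, M.edge} := by
      apply le_antisymm <;> rw [Subgroup.closure_le] <;> rintro x (rfl | rfl)
      · exact mul_mem (Subgroup.subset_closure (by simp)) (Subgroup.subset_closure (by simp))
      · exact Subgroup.subset_closure (by simp)
      · have h1 : M.vert = M.face * M.edge := by
          rw [face, mul_assoc, edge_mul_edge, mul_one]
        have h2 : M.face * M.edge ∈ Subgroup.closure {M.face, M.edge} :=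
          mul_mem (Subgroup.subset_closure (by simp)) (Subgroup.subset_closure (by simp))
        rw [← h1] at h2
        exact h2
      · exact Subgroup.subset_closure (by simp)
    rw [h]
    exact M.connected

theorem dual_face : M.dual.face = M.vert := by
  show M.vert * M.edge * M.edge = M.vert
  rw [mul_assoc, edge_mul_edge, mul_one]

/-! ### Regions -/

/-- A vertex (that is, its star) involves some edge of the region `R`. -/
def VertexMeets (s : M.Vertex) (R : Set M.Edge) : Prop :=
  ∃ d, M.vertexOf d = s ∧ M.edgeOf d ∈ R

/-- A plaquette involves some edge of the region `R`. -/
def FaceMeets (p : M.Face) (R : Set M.Edge) : Prop :=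
  ∃ d, M.faceOf d = p ∧ M.edgeOf d ∈ R

/-- Two regions share a border when some star or some plaquette involves both. -/
def ShareBorder (R S : Set M.Edge) : Prop :=
  (∃ s, M.VertexMeets s R ∧ M.VertexMeets s S) ∨ (∃ p, M.FaceMeets p R ∧ M.FaceMeets p S)

/-- The number of plaquettes spanning the boundary between two regions. -/
def borderCount (R S : Set M.Edge) : ℕ :=
  Nat.card {p : M.Face // M.FaceMeets p R ∧ M.FaceMeets p S}

/-- An edge path inside the region `R`: each dart starts where the previous one ends. -/
def IsPath (R : Set M.Edge) (l : List D) : Prop :=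
  (∀ d ∈ l, M.edgeOf d ∈ R) ∧ l.IsChain fun d d' => M.vertexOf (M.edge d) = M.vertexOf d'

/-- A closed edge path (a loop) inside the region `R`. -/
def IsClosedPath (R : Set M.Edge) (l : List D) : Prop :=
  M.IsPath R l ∧ ∀ d ∈ l.getLast?, ∀ d' ∈ l.head?, M.vertexOf (M.edge d) = M.vertexOf d'

/-- The boundary walk of the face of the dart `d`, starting with `d`. -/
def faceWalk (d : D) : List D := List.iterate M.face d (Function.minimalPeriod M.face d)

/-- Combinatorial homotopy of edge paths inside `R`: the equivalence relation generated by
inserting a backtrack, or inserting the boundary walk of a face, all paths staying inside `R`. -/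
def Homotopic (R : Set M.Edge) : List D → List D → Prop :=
  Relation.EqvGen fun l l' => M.IsPath R l ∧ M.IsPath R l' ∧
    ∃ l₁ l₂ d, l = l₁ ++ l₂ ∧
      (l' = l₁ ++ [d, M.edge d] ++ l₂ ∨ l' = l₁ ++ M.faceWalk d ++ l₂)

/-- Any two edges of `R` can be joined by an edge path inside `R`. -/
def PathConnected (R : Set M.Edge) : Prop :=
  ∀ d d', M.edgeOf d ∈ R → M.edgeOf d' ∈ R → ∃ l, M.IsPath R (d :: (l ++ [d']))

/-- A contractible, simply connected region. It is nonempty and connected (one can go from any edge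
of it to any other through plaquettes, crossing only edges of the region); every loop of lattice
edges inside the region contracts inside the region; and every loop of the dual lattice crossing
only edges of the region is contractible on the surface. -/
structure IsContractible (R : Set M.Edge) : Prop where
  nonempty : R.Nonempty
  connected : M.dual.PathConnected R
  loops : ∀ l, M.IsClosedPath R l → M.Homotopic R l []
  dual_loops : ∀ l, M.dual.IsClosedPath R l → M.dual.Homotopic Set.univ l []

end SurfaceMap

/-! ### Qubits -/

/-- Configurations of the computational basis of qubits labelled by `ι`. -/
def QubitConfig (ι : Type*) : Type _ := ι → Fin 2

instance {ι : Type*} [Finite ι] : Fintype (QubitConfig ι) :=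
  haveI : Finite (QubitConfig ι) := inferInstanceAs (Finite (ι → Fin 2))
  Fintype.ofFinite _

instance {ι : Type*} : DecidableEq (QubitConfig ι) := Classical.decEq _

/-- The Hilbert space `(ℂ²)^{⊗ ι}`, in the computational product basis. -/
abbrev QubitSpace (ι : Type*) : Type _ := EuclideanSpace ℂ (QubitConfig ι)

/-- The configuration seen by a subset of the qubits. -/
def QubitConfig.restrict {ι : Type*} (s : QubitConfig ι) (R : Set ι) : QubitConfig R :=
  fun i => s i

def sigmaX : Matrix (Fin 2) (Fin 2) ℂ := !![0, 1; 1, 0]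
def sigmaZ : Matrix (Fin 2) (Fin 2) ℂ := !![1, 0; 0, -1]

/-- The operator `⨂ᵢ Oᵢ`. -/
def tensorOp {ι : Type*} [Fintype ι] (O : ι → Matrix (Fin 2) (Fin 2) ℂ) :
    Module.End ℂ (QubitSpace ι) :=
  Matrix.toEuclideanLin (Matrix.of fun s t : QubitConfig ι => ∏ i, O i (s i) (t i))

/-- The state `|+⋯+⟩`. -/
def plusState (ι : Type*) [Fintype ι] : QubitSpace ι :=
  WithLp.toLp 2 fun _ => ∏ _i : ι, ((Real.sqrt 2 : ℝ) : ℂ)⁻¹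

namespace SurfaceMap

variable {D : Type*} [Fintype D] (M : SurfaceMap D)

/-- How many ends of the edge `i` are at the vertex `s`. -/
def vertexMult (s : M.Vertex) (i : M.Edge) : ℕ :=
  Nat.card {d : D // M.vertexOf d = s ∧ M.edgeOf d = i}

/-- How many sides of the edge `i` are on the face `p`. -/
def faceMult (p : M.Face) (i : M.Edge) : ℕ :=
  Nat.card {d : D // M.faceOf d = p ∧ M.edgeOf d = i}

/-- The star operator, the product of `σˣ` over the legs of `s`. -/
def starOp (s : M.Vertex) : Module.End ℂ (QubitSpace M.Edge) :=
  tensorOp fun i => sigmaX ^ M.vertexMult s i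

/-- The plaquette operator, the product of `σᶻ` over the boundary of `p`. -/
def plaquetteOp (p : M.Face) : Module.End ℂ (QubitSpace M.Edge) :=
  tensorOp fun i => sigmaZ ^ M.faceMult p i

/-- The toric code Hamiltonian `-U ∑ₛ Aₛ - J ∑ₚ Bₚ`. -/
def hamiltonian (U J : ℝ) : Module.End ℂ (QubitSpace M.Edge) :=
  -((U : ℂ) • ∑ s, M.starOp s) - (J : ℂ) • ∑ p, M.plaquetteOp p

/-- A normalised eigenvector of the Hamiltonian for its lowest eigenvalue. -/
def IsGroundState (U J : ℝ) (ψ : QubitSpace M.Edge) : Prop :=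
  ‖ψ‖ = 1 ∧ ∃ E : ℝ, (M.hamiltonian U J).HasEigenvector (E : ℂ) ψ ∧
    ∀ E' : ℝ, (M.hamiltonian U J).HasEigenvalue (E' : ℂ) → E ≤ E'

/-- A loop configuration (mod 2 cycle): an edge set with an even number of ends at each vertex. -/
def IsLoop (c : Finset M.Edge) : Prop :=
  ∀ s : M.Vertex, Even (∑ i ∈ c, M.vertexMult s i)

open Classical in
/-- The loop operator, the product of `σᶻ` over the edges of `c`. -/
def loopOp (c : Finset M.Edge) : Module.End ℂ (QubitSpace M.Edge) :=
  tensorOp fun i => if i ∈ c then sigmaZ else 1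

open Classical in
/-- `∑_c W^z_c |+⋯+⟩`, over all loop configurations `c`, contractible or not. -/
def loopSum : QubitSpace M.Edge :=
  ∑ c : Finset M.Edge with M.IsLoop c, M.loopOp c (plusState M.Edge)

/-- The ground state `ψ₀`: the normalised equal-weight superposition of all loops of `σᶻ` operators
acting on `|+⋯+⟩`. -/
def psiZero : QubitSpace M.Edge :=
  ((‖M.loopSum‖ : ℝ) : ℂ)⁻¹ • M.loopSum

variable {M} in
/-- `ψ = m^{-1/2} ∑_μ (n^{-1/2} ∑_ν e_{μν} ⊗ g_ν) ⊗ (k^{-1/2} ∑_τ f_{μτ} ⊗ h_τ)`, written in the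
product basis. -/
def IsNestedSum {A₁ A₂ B₁ B₂ : Set M.Edge} {m n k : ℕ}
    (e : Fin m → Fin n → QubitSpace A₁) (g : Fin n → QubitSpace A₂)
    (f : Fin m → Fin k → QubitSpace B₁) (h : Fin k → QubitSpace B₂)
    (ψ : QubitSpace M.Edge) : Prop :=
  ∀ s : QubitConfig M.Edge, ψ s =
    ((Real.sqrt m : ℝ) : ℂ)⁻¹ * ∑ μ : Fin m,
      (((Real.sqrt n : ℝ) : ℂ)⁻¹ *
          ∑ ν : Fin n, e μ ν (s.restrict A₁) * g ν (s.restrict A₂)) *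
        (((Real.sqrt k : ℝ) : ℂ)⁻¹ *
          ∑ τ : Fin k, f μ τ (s.restrict B₁) * h τ (s.restrict B₂))

end SurfaceMap

end

/-! Write basis states as bit strings `x` on the edges. A star operator translates `x` by the
gradient `cob` of a vertex, and a plaquette operator multiplies the amplitude by the sign of the
flux `bd x p`. The loop sum is fixed by all these operators, so it attains the least conceivable
energy. Every ground state must then be fixed by each operator too (`IsGroundState.isStabilized`).
Its amplitude is therefore invariant under gradients and supported on flux-free strings.

If `x` is flux-free, its parts on `A`, `A₂` and `B₂` have flux only through plaquettes at the
borders `A₁B₁`, `A₁A₂` and `B₁B₂`. The total flux of each part is even, because an edge has two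
sides. These three fluxes are the labels `μ`, `ν`, `τ`. An even subset of `n ≥ 1` plaquettes can be
chosen in `2 ^ (n - 1)` ways. The states `e`, `g`, `h` are uniform superpositions of all strings
with a prescribed flux.

Each clause of contractibility has its own role. Connectedness realises every even flux
(`exists_bd_eq`). Contractibility of dual loops makes two strings with equal flux differ by a
gradient (`exists_cob_of_dual_loops`). The amplitude of `x` thus depends only on `μ`, `τ` and the
part of `x` in `B₁`, which defines `f`. Contractibility of lattice loops makes flux-free labellings
gradients (`exists_cob_eq_of_loops`). This moves all labels `(μ, τ)` to the trivial one, so all the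
vectors `f` have the same norm. It also realises fluxes within `A₁`, which is not assumed connected.
-/

namespace SurfaceMap

/-! ### Edge walks, potentials and homotopy invariance -/

section Walks

variable {D : Type*} (M : SurfaceMap D)

theorem edgeOf_edge (d : D) : M.edgeOf (M.edge d) = M.edgeOf d :=
  Quotient.sound (⟨-1, by simp⟩ : M.edge.SameCycle (M.edge d) d)

theorem faceOf_face (d : D) : M.faceOf (M.face d) = M.faceOf d :=
  Quotient.sound (⟨-1, by simp⟩ : M.face.SameCycle (M.face d) d)

theorem vertexOf_vert (d : D) : M.vertexOf (M.vert d) = M.vertexOf d :=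
  Quotient.sound (⟨-1, by simp⟩ : M.vert.SameCycle (M.vert d) d)

theorem vertexOf_face (d : D) : M.vertexOf (M.face d) = M.vertexOf (M.edge d) :=
  M.vertexOf_vert (M.edge d)

theorem edgeOf_eq_iff {d d' : D} : M.edgeOf d' = M.edgeOf d ↔ d' = d ∨ d' = M.edge d := by
  constructor
  · intro h
    obtain ⟨i, hi⟩ : M.edge.SameCycle d' d := Quotient.exact h
    have h2 : M.edge ^ (2 : ℤ) = 1 := by
      rw [zpow_ofNat, pow_two, M.edge_mul_edge]
    rcases Int.even_or_odd' i with ⟨k, rfl | rfl⟩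
    · rw [zpow_mul, h2, one_zpow] at hi
      exact Or.inl hi
    · rw [zpow_add, zpow_mul, h2, one_zpow, zpow_one, one_mul] at hi
      right
      rw [← hi, M.edge_edge]
  · rintro (rfl | rfl)
    · rfl
    · exact M.edgeOf_edge d

theorem exists_edgeOf (i : M.Edge) : ∃ d, M.edgeOf d = i := Quotient.exists_rep i

theorem dual_faceOf_eq_iff {d d' : D} :
    M.dual.faceOf d' = M.dual.faceOf d ↔ M.vertexOf d' = M.vertexOf d := by
  unfold faceOf vertexOf
  rw [Quotient.eq, Quotient.eq]
  change M.dual.face.SameCycle d' d ↔ M.vert.SameCycle d' d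
  rw [M.dual_face]

/-- There is an edge path inside `R` between two vertices, along which `g` sums to `t`. -/
inductive Walk (R : Set M.Edge) {X : Type*} [AddCommGroup X] (g : D → X) :
    M.Vertex → M.Vertex → X → Prop
  | nil (v : M.Vertex) : Walk R g v v 0
  | cons (d : D) {w : M.Vertex} {t : X} : M.edgeOf d ∈ R →
      Walk R g (M.vertexOf (M.edge d)) w t → Walk R g (M.vertexOf d) w (g d + t)

namespace Walk

variable {M} {R : Set M.Edge} {X : Type*} [AddCommGroup X] {g : D → X}

theorem trans {u v w : M.Vertex} {s t : X} (h : M.Walk R g u v s) (h' : M.Walk R g v w t) :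
    M.Walk R g u w (s + t) := by
  induction h with
  | nil v => simpa using h'
  | cons d hd _ ih => rw [add_assoc]; exact cons d hd (ih h')

theorem single {d : D} (hd : M.edgeOf d ∈ R) :
    M.Walk R g (M.vertexOf d) (M.vertexOf (M.edge d)) (g d) := by
  simpa using cons (g := g) d hd (nil _)

theorem symm (hg : ∀ d, g (M.edge d) = g d) {v w : M.Vertex} {t : X} (h : M.Walk R g v w t) :
    M.Walk R g w v t := by
  induction h with
  | nil v => exact nil v
  | cons d hd _ ih =>
    have h1 := single (g := g) (d := M.edge d) (by rwa [M.edgeOf_edge])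
    rw [M.edge_edge, hg] at h1
    rw [add_comm]
    exact ih.trans h1

/-- This passes to the form used by `IsClosedPath`. The empty list needs a clause of its own, since
it has no dart to record the endpoints. -/
theorem exists_list {v w : M.Vertex} {t : X} (h : M.Walk R g v w t) :
    ∃ l : List D, M.IsPath R l ∧ (l.map g).sum = t ∧ (l = [] → v = w) ∧
      (∀ d ∈ l.head?, M.vertexOf d = v) ∧ ∀ d ∈ l.getLast?, M.vertexOf (M.edge d) = w := by
  induction h with
  | nil v => exact ⟨[], ⟨by simp, List.isChain_nil⟩, by simp⟩
  | cons d hd _ ih =>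
    obtain ⟨l, ⟨hR, hc⟩, hs, hn, hh, hl⟩ := ih
    refine ⟨d :: l, ⟨?_, ?_⟩, by simp [hs], by simp, by simp, ?_⟩
    · intro x hx
      rcases List.mem_cons.1 hx with rfl | hx
      · exact hd
      · exact hR x hx
    · rw [List.isChain_cons]
      exact ⟨fun y hy => (hh y hy).symm, hc⟩
    · intro x hx
      rcases l with _ | ⟨y, l⟩
      · simp at hx
        subst hx
        exact hn rfl
      · rw [List.getLast?_cons_cons] at hx
        exact hl x hx

theorem mem_of_closed {S : AddSubgroup X}
    (hS : ∀ l, M.IsClosedPath R l → (l.map g).sum ∈ S) {v : M.Vertex} {t : X}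
    (h : M.Walk R g v v t) : t ∈ S := by
  obtain ⟨l, hp, rfl, -, hh, hl⟩ := h.exists_list
  exact hS l ⟨hp, fun d hd d' hd' => (hl d hd).trans (hh d' hd').symm⟩

end Walk

/-- A symmetric function on darts whose sums over closed paths lie in `S` is, modulo `S`, the
gradient of a function on vertices. -/
theorem exists_potential {R : Set M.Edge} {X : Type*} [AddCommGroup X] {g : D → X}
    (hg : ∀ d, g (M.edge d) = g d) {S : AddSubgroup X}
    (hS : ∀ l, M.IsClosedPath R l → (l.map g).sum ∈ S) :
    ∃ φ : M.Vertex → X, ∀ d, M.edgeOf d ∈ R →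
      g d + (φ (M.vertexOf d) + φ (M.vertexOf (M.edge d))) ∈ S := by
  let r : Setoid M.Vertex :=
    { r := fun v w => ∃ t, M.Walk R g v w t
      iseqv := ⟨fun v => ⟨0, .nil v⟩, fun ⟨t, h⟩ => ⟨t, h.symm hg⟩,
        fun ⟨s, h⟩ ⟨t, h'⟩ => ⟨s + t, h.trans h'⟩⟩ }
  -- Each walk component is based at a representative, and `φ v` is the sum along a chosen walk from
  -- there to `v`.
  have hrep : ∀ v, ∃ t, M.Walk R g (Quotient.mk r v).out v t := fun v => Quotient.mk_out v
  choose φ hφ using hrep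
  refine ⟨φ, fun d hd => ?_⟩
  have hs : M.Walk R g (M.vertexOf d) (M.vertexOf (M.edge d)) (g d) := .single hd
  have he : Quotient.mk r (M.vertexOf d) = Quotient.mk r (M.vertexOf (M.edge d)) :=
    Quotient.sound ⟨_, hs⟩
  have h1 := hφ (M.vertexOf d)
  rw [he] at h1
  -- The closed walk follows `d`, returns to the representative and comes out again. Reversal
  -- preserves sums, so both values of `φ` enter with a plus sign.
  have h2 := ((hs.trans ((hφ (M.vertexOf (M.edge d))).symm hg)).trans h1).mem_of_closed hS
  convert h2 using 1
  abel

/-- A backtrack adds `g d + g d = 0`, and a face walk adds an element of `S`. This serves twice: on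
the surface with `S = ⊥` for labellings without flux, and on the dual with `S` the group of
gradients. -/
theorem sum_sub_mem_of_homotopic {R : Set M.Edge} {X : Type*} [AddCommGroup X]
    (hX : ∀ x : X, x + x = 0) {g : D → X} (hg : ∀ d, g (M.edge d) = g d) {S : AddSubgroup X}
    (hS : ∀ d, (∀ d' ∈ M.faceWalk d, M.edgeOf d' ∈ R) → ((M.faceWalk d).map g).sum ∈ S)
    {l l' : List D} (h : M.Homotopic R l l') : (l.map g).sum - (l'.map g).sum ∈ S := by
  induction h with
  | rel l l' h =>
    obtain ⟨-, ⟨hR, -⟩, l₁, l₂, d, rfl, rfl | rfl⟩ := h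
    · have : ((l₁ ++ l₂).map g).sum - ((l₁ ++ [d, M.edge d] ++ l₂).map g).sum = 0 := by
        simp [hg, ← add_assoc (g d), hX]
      rw [this]
      exact S.zero_mem
    · have : ((l₁ ++ l₂).map g).sum - ((l₁ ++ M.faceWalk d ++ l₂).map g).sum =
          -((M.faceWalk d).map g).sum := by
        simp
      rw [this]
      exact S.neg_mem (hS d fun d' hd' => hR d' (by simp [hd']))
  | refl l => simp
  | symm l l' _ ih => simpa using S.neg_mem ih
  | trans l l' l'' _ _ ih ih' => simpa using S.add_mem ih ih'

theorem faceWalk_eq_map (d : D) :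
    M.faceWalk d = (List.range (Function.minimalPeriod M.face d)).map (M.face^[·] d) :=
  (List.range_map_iterate _ _ _).symm

theorem mem_periodicPts_face [Finite D] (d : D) : d ∈ Function.periodicPts M.face :=
  M.face.injective.mem_periodicPts d

theorem nodup_faceWalk (d : D) : (M.faceWalk d).Nodup := by
  rw [faceWalk_eq_map, ← Cycle.nodup_coe_iff, ← Function.periodicOrbit_def]
  exact Function.nodup_periodicOrbit

theorem mem_faceWalk [Finite D] {d d' : D} : d' ∈ M.faceWalk d ↔ M.faceOf d' = M.faceOf d := by
  rw [faceWalk_eq_map, ← Cycle.mem_coe_iff, ← Function.periodicOrbit_def,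
    Function.mem_periodicOrbit_iff (M.mem_periodicPts_face d)]
  constructor
  · rintro ⟨n, rfl⟩
    exact (Quotient.sound (⟨n, by simp [Equiv.Perm.iterate_eq_pow]⟩ :
      M.face.SameCycle d (M.face^[n] d))).symm
  · intro h
    have h1 : M.face.SameCycle d d' := Equiv.Perm.SameCycle.symm (Quotient.exact h)
    obtain ⟨n, hn⟩ := h1.exists_nat_pow_eq
    exact ⟨n, by rw [Equiv.Perm.iterate_eq_pow]; exact hn⟩

end Walks

end SurfaceMap

/-! ### Mod 2 flux and gradient on the cellulation -/

namespace SurfaceMap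

section Chains

open scoped Classical

variable {D : Type*} [Fintype D] (M : SurfaceMap D)

/-- The mod 2 sum of an edge labelling around each face, with multiplicity. -/
noncomputable def bd : (M.Edge → ZMod 2) →+ (M.Face → ZMod 2) where
  toFun x p := ∑ d with M.faceOf d = p, x (M.edgeOf d)
  map_zero' := by ext; simp
  map_add' x y := by ext; simp [Finset.sum_add_distrib]

/-- The mod 2 gradient of a vertex labelling. -/
noncomputable def cob : (M.Vertex → ZMod 2) →+ (M.Edge → ZMod 2) where
  toFun φ i := ∑ d with M.edgeOf d = i, φ (M.vertexOf d)
  map_zero' := by ext; simp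
  map_add' x y := by ext; simp [Finset.sum_add_distrib]

theorem bd_apply (x : M.Edge → ZMod 2) (p : M.Face) :
    M.bd x p = ∑ d with M.faceOf d = p, x (M.edgeOf d) := rfl

theorem cob_apply (φ : M.Vertex → ZMod 2) (i : M.Edge) :
    M.cob φ i = ∑ d with M.edgeOf d = i, φ (M.vertexOf d) := rfl

theorem sum_darts_of_edge {X : Type*} [AddCommMonoid X] (f : D → X) (d : D) :
    ∑ d' with M.edgeOf d' = M.edgeOf d, f d' = f d + f (M.edge d) := by
  have : (Finset.univ.filter fun d' => M.edgeOf d' = M.edgeOf d) = {d, M.edge d} := by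
    ext d'
    simp [M.edgeOf_eq_iff]
  rw [this, Finset.sum_pair (M.edge_ne d).symm]

theorem cob_edgeOf (φ : M.Vertex → ZMod 2) (d : D) :
    M.cob φ (M.edgeOf d) = φ (M.vertexOf d) + φ (M.vertexOf (M.edge d)) :=
  M.sum_darts_of_edge (fun d => φ (M.vertexOf d)) d

/-- Around a face, the end of each dart is the start of the next, so every vertex value is counted
twice. -/
theorem bd_cob (φ : M.Vertex → ZMod 2) : M.bd (M.cob φ) = 0 := by
  ext p
  simp only [bd_apply, cob_edgeOf, Finset.sum_add_distrib, ← M.vertexOf_face, Pi.zero_apply]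
  have : ∑ d with M.faceOf d = p, φ (M.vertexOf (M.face d)) =
      ∑ d with M.faceOf d = p, φ (M.vertexOf d) :=
    Finset.sum_equiv M.face (by simp [M.faceOf_face]) (by simp)
  rw [this]
  exact CharTwo.add_self_eq_zero _

theorem bd_eq_zero_of_not_faceMeets {R : Set M.Edge} {x : M.Edge → ZMod 2}
    (hx : ∀ i ∉ R, x i = 0) {p : M.Face} (hp : ¬ M.FaceMeets p R) : M.bd x p = 0 := by
  refine Finset.sum_eq_zero fun d hd => hx _ fun hR => hp ⟨d, ?_, hR⟩
  simpa using hd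

theorem bd_congr {x y : M.Edge → ZMod 2} {p : M.Face}
    (h : ∀ d, M.faceOf d = p → x (M.edgeOf d) = y (M.edgeOf d)) : M.bd x p = M.bd y p :=
  Finset.sum_congr rfl fun d hd => h d (by simpa using hd)

/-- The two darts of an edge cancel. -/
theorem sum_bd (x : M.Edge → ZMod 2) : ∑ p, M.bd x p = 0 := by
  simp only [bd_apply]
  rw [Finset.sum_fiberwise]
  refine Finset.sum_involution (fun d _ => M.edge d) ?_ ?_ ?_ ?_
  · intro d _
    rw [M.edgeOf_edge]
    exact CharTwo.add_self_eq_zero _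
  · exact fun d _ _ => M.edge_ne d
  · simp
  · exact fun d _ => M.edge_edge d

/-- Inside a region whose loops contract, a labelling without flux is a gradient. The gradient can
be chosen to vanish on edges that have no vertex in common with the region. -/
theorem exists_cob_eq_of_loops {R S : Set M.Edge}
    (hR : ∀ l, M.IsClosedPath R l → M.Homotopic R l [])
    (hS : ∀ d, M.edgeOf d ∈ S → ¬ M.VertexMeets (M.vertexOf d) R) {y : M.Edge → ZMod 2}
    (hy : ∀ p, (∀ d, M.faceOf d = p → M.edgeOf d ∈ R) → M.bd y p = 0) :
    ∃ φ, (∀ i ∈ R, M.cob φ i = y i) ∧ ∀ i ∈ S, M.cob φ i = 0 := by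
  have hg : ∀ d, y (M.edgeOf (M.edge d)) = y (M.edgeOf d) := fun d => by rw [M.edgeOf_edge]
  have hwalk : ∀ d, (∀ d' ∈ M.faceWalk d, M.edgeOf d' ∈ R) →
      ((M.faceWalk d).map fun d => y (M.edgeOf d)).sum ∈ (⊥ : AddSubgroup (ZMod 2)) := by
    intro d hd
    rw [AddSubgroup.mem_bot, ← List.sum_toFinset _ (M.nodup_faceWalk d),
      ← hy (M.faceOf d) fun d' h => hd d' (M.mem_faceWalk.2 h), bd_apply]
    refine Finset.sum_congr ?_ fun _ _ => rfl
    ext d'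
    simp [M.mem_faceWalk]
  obtain ⟨φ, hφ⟩ := M.exists_potential (R := R) (g := fun d => y (M.edgeOf d)) (S := ⊥) hg
    fun l hl => by
      simpa using M.sum_sub_mem_of_homotopic (fun x => CharTwo.add_self_eq_zero x) hg hwalk
        (hR l hl)
  -- Cutting the potential off away from the vertices of `R` changes nothing on edges of `R`, whose
  -- two ends both meet `R`, and kills the gradient on `S`.
  refine ⟨fun v => if M.VertexMeets v R then φ v else 0, fun i hi => ?_, fun i hi => ?_⟩
  · obtain ⟨d, rfl⟩ := M.exists_edgeOf i
    have h1 := hφ d hi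
    rw [AddSubgroup.mem_bot] at h1
    rw [cob_edgeOf, if_pos ⟨d, rfl, hi⟩, if_pos ⟨M.edge d, rfl, by rwa [M.edgeOf_edge]⟩]
    exact (CharTwo.add_eq_zero.1 h1).symm
  · obtain ⟨d, rfl⟩ := M.exists_edgeOf i
    rw [cob_edgeOf, if_neg (hS d hi), if_neg (hS _ (by rwa [M.edgeOf_edge])), add_zero]

/-- In a region whose dual loops contract on the surface, a cocycle is a coboundary. -/
theorem exists_cob_of_dual_loops {R : Set M.Edge}
    (hR : ∀ l, M.dual.IsClosedPath R l → M.dual.Homotopic Set.univ l []) {z : M.Edge → ZMod 2}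
    (hz : ∀ i ∉ R, z i = 0) (hb : M.bd z = 0) : ∃ φ, M.cob φ = z := by
  -- A dual path is summed to the chain of edges it crosses. A face of the dual is a vertex, and the
  -- chain of its walk is the gradient of that vertex.
  let g : D → M.Edge → ZMod 2 := fun d => Pi.single (M.edgeOf d) 1
  have hg : ∀ d, g (M.edge d) = g d := fun d => by simp only [g, M.edgeOf_edge]
  have hwalk : ∀ d, (∀ d' ∈ M.dual.faceWalk d, M.dual.edgeOf d' ∈ Set.univ) →
      ((M.dual.faceWalk d).map g).sum ∈ M.cob.range := by
    intro d _
    refine ⟨Pi.single (M.vertexOf d) 1, ?_⟩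
    rw [← List.sum_toFinset _ (M.dual.nodup_faceWalk d)]
    have : (M.dual.faceWalk d).toFinset = Finset.univ.filter fun d' =>
        M.vertexOf d' = M.vertexOf d := by
      ext d'
      simp [M.dual.mem_faceWalk, M.dual_faceOf_eq_iff]
    rw [this]
    ext i
    simp only [cob_apply, Finset.sum_apply, g, Finset.sum_filter, Pi.single_apply, eq_comm (a := i)]
    refine Finset.sum_congr rfl fun d' _ => ?_
    split_ifs <;> rfl
  obtain ⟨φ, hφ⟩ := M.dual.exists_potential (R := R) (g := g) (S := M.cob.range) hg
    fun l hl => by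
      simpa using M.dual.sum_sub_mem_of_homotopic
        (fun x => funext fun i => CharTwo.add_self_eq_zero (x i)) hg hwalk (hR l hl)
  change M.Face → M.Edge → ZMod 2 at φ
  change ∀ d, M.edgeOf d ∈ R → g d + (φ (M.faceOf d) + φ (M.faceOf (M.edge d))) ∈ M.cob.range at hφ
  -- Modulo gradients, an edge of `R` equals the sum of `φ` over its two faces. Weighted by `z`,
  -- these face terms regroup as `bd z p • φ p` and vanish, leaving `z` itself.
  have h1 : ∑ i : M.Edge, z i • (Pi.single i 1 + ∑ d with M.edgeOf d = i, φ (M.faceOf d)) ∈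
      M.cob.range := by
    refine sum_mem fun i _ => ?_
    by_cases hi : i ∈ R
    · obtain ⟨d, rfl⟩ := M.exists_edgeOf i
      rw [M.sum_darts_of_edge fun d => φ (M.faceOf d)]
      exact ZMod.smul_mem (hφ d hi) _
    · rw [hz i hi, zero_smul]
      exact zero_mem _
  have h2 : ∑ i : M.Edge, z i • ∑ d with M.edgeOf d = i, φ (M.faceOf d) = 0 := by
    have : ∀ i : M.Edge, z i • ∑ d with M.edgeOf d = i, φ (M.faceOf d) =
        ∑ d with M.edgeOf d = i, z (M.edgeOf d) • φ (M.faceOf d) := by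
      intro i
      rw [Finset.smul_sum]
      exact Finset.sum_congr rfl fun d hd => by rw [(Finset.mem_filter.1 hd).2]
    simp only [this]
    rw [Finset.sum_fiberwise, ← Finset.sum_fiberwise Finset.univ M.faceOf]
    refine Finset.sum_eq_zero fun p _ => ?_
    have : ∑ d with M.faceOf d = p, z (M.edgeOf d) • φ (M.faceOf d) = M.bd z p • φ p := by
      rw [bd_apply, Finset.sum_smul]
      exact Finset.sum_congr rfl fun d hd => by rw [(Finset.mem_filter.1 hd).2]
    rw [this, hb, Pi.zero_apply, zero_smul]
  simp only [smul_add, Finset.sum_add_distrib] at h1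
  rw [h2, add_zero] at h1
  convert AddMonoidHom.mem_range.1 h1
  ext i
  simp [Finset.sum_apply, Pi.single_apply]

theorem bd_single (d : D) :
    M.bd (Pi.single (M.edgeOf d) 1) = Pi.single (M.faceOf d) 1 + Pi.single (M.faceOf (M.edge d)) 1 := by
  ext p
  rw [Pi.add_apply, ← M.sum_darts_of_edge (fun d => (Pi.single (M.faceOf d) 1 : M.Face → ZMod 2) p)]
  simp only [bd_apply, Finset.sum_filter, Pi.single_apply, eq_comm (a := p)]
  refine Finset.sum_congr rfl fun d' _ => ?_
  split_ifs <;> rfl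

/-- Consecutive edges of a dual path share a face, whose two contributions cancel; only the faces at
the ends survive. -/
theorem exists_bd_eq_of_path {R : Set M.Edge} (d' : D) (l : List D) :
    ∀ d, M.dual.IsPath R (d :: (l ++ [d'])) → ∃ x : M.Edge → ZMod 2, (∀ i ∉ R, x i = 0) ∧
      M.bd x = Pi.single (M.faceOf d) 1 + Pi.single (M.faceOf (M.edge d')) 1 := by
  have hsing : ∀ d, M.edgeOf d ∈ R → ∀ i ∉ R,
      (Pi.single (M.edgeOf d) 1 : M.Edge → ZMod 2) i = 0 := by
    intro d hd i hi
    rw [Pi.single_apply, if_neg]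
    rintro rfl
    exact hi hd
  have hdouble : ∀ p : M.Face, (Pi.single p 1 : M.Face → ZMod 2) + Pi.single p 1 = 0 :=
    fun p => funext fun _ => CharTwo.add_self_eq_zero _
  have hstep : ∀ d e, M.edgeOf d ∈ R → M.faceOf (M.edge d) = M.faceOf e →
      ∀ q, (∃ x : M.Edge → ZMod 2, (∀ i ∉ R, x i = 0) ∧
        M.bd x = Pi.single (M.faceOf e) 1 + Pi.single q 1) →
      ∃ x : M.Edge → ZMod 2, (∀ i ∉ R, x i = 0) ∧
        M.bd x = Pi.single (M.faceOf d) 1 + Pi.single q 1 := by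
    rintro d e hd he q ⟨x, hx, hbx⟩
    refine ⟨Pi.single (M.edgeOf d) 1 + x, fun i hi => ?_, ?_⟩
    · rw [Pi.add_apply, hx i hi, hsing d hd i hi, add_zero]
    · rw [map_add, hbx, M.bd_single, he, add_assoc, ← add_assoc (Pi.single (M.faceOf e) 1), hdouble,
        zero_add]
  induction l with
  | nil =>
    rintro d ⟨hR, hc⟩
    have hd : M.edgeOf d ∈ R := hR d (by simp)
    have hd' : M.edgeOf d' ∈ R := hR d' (by simp)
    have he : M.faceOf (M.edge d) = M.faceOf d' := by
      simp only [List.nil_append, List.isChain_cons_cons] at hc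
      exact hc.1
    exact hstep d d' hd he _ ⟨_, hsing d' hd', M.bd_single d'⟩
  | cons e l ih =>
    rintro d ⟨hR, hc⟩
    simp only [List.cons_append, List.isChain_cons_cons] at hc
    exact hstep d e (hR d (by simp)) hc.1 _
      (ih e ⟨fun d hd => hR d (List.mem_cons_of_mem _ hd), hc.2⟩)

/-- In a region connected through plaquettes, every even flux is realised. -/
theorem exists_bd_eq {R : Set M.Edge} (hR : M.dual.PathConnected R) {t : M.Face → ZMod 2}
    (ht : ∀ p, ¬ M.FaceMeets p R → t p = 0) (hsum : ∑ p, t p = 0) :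
    ∃ x : M.Edge → ZMod 2, (∀ i ∉ R, x i = 0) ∧ M.bd x = t := by
  by_cases hne : ∃ p, M.FaceMeets p R
  · obtain ⟨_, d₀, rfl, hd₀⟩ := hne
    -- Each face is paired with one base face. The base contributions cancel at the end because the
    -- total of `t` is even.
    have h1 : ∀ p, ∃ x : M.Edge → ZMod 2, (∀ i ∉ R, x i = 0) ∧
        M.bd x = t p • (Pi.single p 1 + Pi.single (M.faceOf d₀) 1) := by
      intro p
      by_cases hp : M.FaceMeets p R
      · obtain ⟨d, rfl, hd⟩ := hp
        -- The path ends with the reversed dart so that the face reached is that of `d₀`.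
        have he : M.edgeOf (M.edge d₀) ∈ R := by rwa [M.edgeOf_edge]
        obtain ⟨l, hl⟩ := hR d (M.edge d₀) hd he
        obtain ⟨x, hx, hbx⟩ := M.exists_bd_eq_of_path _ l d hl
        rw [M.edge_edge] at hbx
        refine ⟨t (M.faceOf d) • x, fun i hi => by simp [hx i hi], ?_⟩
        rw [← hbx]
        exact ZMod.map_smul M.bd _ _
      · exact ⟨0, by simp, by simp [ht p hp]⟩
    choose x hx hbx using h1
    refine ⟨∑ p, x p, fun i hi => ?_, ?_⟩
    · rw [Finset.sum_apply]
      exact Finset.sum_eq_zero fun p _ => hx p i hi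
    · simp only [map_sum, hbx, smul_add, Finset.sum_add_distrib]
      rw [← Finset.sum_smul, hsum, zero_smul, add_zero]
      ext p
      simp [Finset.sum_apply, Pi.single_apply]
  · push Not at hne
    exact ⟨0, by simp, by ext p; simp [ht p (hne p)]⟩

/-- A nonempty region with nonempty complement has a plaquette on its boundary. -/
theorem exists_border_face {R : Set M.Edge} (hR : R.Nonempty) (hR' : Rᶜ.Nonempty) :
    ∃ p, M.FaceMeets p R ∧ M.FaceMeets p Rᶜ := by
  by_contra! h
  obtain ⟨i, hi⟩ := hR
  obtain ⟨j, hj⟩ := hR'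
  obtain ⟨d, rfl⟩ := M.exists_edgeOf i
  obtain ⟨d', rfl⟩ := M.exists_edgeOf j
  -- Without a border face, membership in `R` is invariant under `face` and `edge`, hence under the
  -- transitive group generated by `vert` and `edge`.
  have hface : ∀ x, M.edgeOf x ∈ R → M.edgeOf (M.face x) ∈ R := fun x hx => by
    by_contra hc
    exact h (M.faceOf x) ⟨x, rfl, hx⟩ ⟨M.face x, M.faceOf_face x, hc⟩
  have hvert : ∀ x, M.edgeOf x ∈ R → M.edgeOf (M.vert x) ∈ R := fun x hx => by
    have h1 : M.vert x = M.face (M.edge x) := by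
      simp [face, M.edge_edge]
    rw [h1]
    exact hface _ (by rwa [M.edgeOf_edge])
  have hvert_inv : ∀ x, M.edgeOf x ∈ R → M.edgeOf (M.vert⁻¹ x) ∈ R := by
    intro x hx
    obtain ⟨n, hn⟩ : ∃ n : ℕ, (M.vert ^ n) x = M.vert⁻¹ x :=
      Equiv.Perm.SameCycle.exists_nat_pow_eq ⟨-1, by simp⟩
    rw [← hn]
    clear hn
    induction n with
    | zero => simpa using hx
    | succ n ih =>
      rw [pow_succ', Equiv.Perm.mul_apply]
      exact hvert _ ih
  obtain ⟨⟨σ, hσ⟩, hd⟩ := M.connected.exists_smul_eq d d'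
  have key : ∀ σ ∈ Subgroup.closure {M.vert, M.edge}, ∀ x, M.edgeOf x ∈ R →
      M.edgeOf (σ x) ∈ R := by
    intro σ hσ
    induction hσ using Subgroup.closure_induction'' with
    | mem f hf =>
      rcases hf with rfl | rfl
      · exact hvert
      · exact fun x hx => by rwa [M.edgeOf_edge]
    | inv_mem f hf =>
      rcases hf with rfl | rfl
      · exact hvert_inv
      · intro x hx
        have : M.edge⁻¹ x = M.edge x := by
          rw [Equiv.Perm.inv_eq_iff_eq, M.edge_edge]
        rwa [this, M.edgeOf_edge]
    | one => exact fun x hx => hx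
    | mul f k _ _ hf hk => exact fun x hx => hf _ (hk x hx)
  apply hj
  have := key σ hσ d hi
  rwa [show σ d = d' from hd] at this

end Chains

end SurfaceMap

/-! ### Bits, signs and products of Pauli matrices -/

theorem zmod_two_cases (x : ZMod 2) : x = 0 ∨ x = 1 := by
  revert x
  decide

/-- A bit as an index of the computational basis of a qubit. -/
def bitFin : ZMod 2 ≃ Fin 2 := Equiv.refl _

/-- Computational basis configurations as bit strings. -/
def bitEquiv (ι : Type*) : (ι → ZMod 2) ≃ QubitConfig ι := Equiv.refl _

/-- The sign of a bit, as a complex number. -/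
noncomputable def bitSign (x : ZMod 2) : ℂ := if x = 0 then 1 else -1

theorem bitSign_zero : bitSign 0 = 1 := if_pos rfl

theorem bitSign_add (x y : ZMod 2) : bitSign (x + y) = bitSign x * bitSign y := by
  rcases zmod_two_cases x with rfl | rfl <;> rcases zmod_two_cases y with rfl | rfl <;>
    simp [bitSign, CharTwo.add_self_eq_zero]

theorem bitSign_sum {ι : Type*} (s : Finset ι) (f : ι → ZMod 2) :
    bitSign (∑ i ∈ s, f i) = ∏ i ∈ s, bitSign (f i) := by
  classical
  induction s using Finset.induction_on with
  | empty => simp [bitSign_zero]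
  | insert a s ha ih => rw [Finset.sum_insert ha, Finset.prod_insert ha, bitSign_add, ih]

theorem norm_bitSign (x : ZMod 2) : ‖bitSign x‖ = 1 := by
  unfold bitSign
  split_ifs <;> simp

theorem bitSign_of_ne_zero {x : ZMod 2} (hx : x ≠ 0) : bitSign x = -1 := if_neg hx

theorem bitFin_zero : bitFin 0 = 0 := rfl

theorem bitFin_one : bitFin 1 = 1 := rfl

theorem natCast_two_mul_zmod (k : ℕ) : ((2 * k : ℕ) : ZMod 2) = 0 := by
  rw [ZMod.natCast_eq_zero_iff]
  exact dvd_mul_right 2 k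

theorem sigmaX_pow_apply (m : ℕ) (a b : ZMod 2) :
    (sigmaX ^ m) (bitFin a) (bitFin b) = if b = a + m then 1 else 0 := by
  have h2 : sigmaX ^ 2 = 1 := by
    ext i j
    fin_cases i <;> fin_cases j <;> simp [sigmaX, pow_two]
  rcases Nat.even_or_odd' m with ⟨k, rfl | rfl⟩
  · rw [pow_mul, h2, one_pow, natCast_two_mul_zmod, add_zero, Matrix.one_apply]
    exact if_congr (bitFin.injective.eq_iff.trans eq_comm) rfl rfl
  · rw [pow_add, pow_mul, h2, one_pow, pow_one, one_mul, Nat.cast_add, natCast_two_mul_zmod]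
    rcases zmod_two_cases a with rfl | rfl <;> rcases zmod_two_cases b with rfl | rfl <;>
      simp [sigmaX, bitFin_zero, bitFin_one, CharTwo.add_self_eq_zero]

theorem sigmaZ_pow_apply (m : ℕ) (a b : ZMod 2) :
    (sigmaZ ^ m) (bitFin a) (bitFin b) = if b = a then bitSign (m * a) else 0 := by
  have h2 : sigmaZ ^ 2 = 1 := by
    ext i j
    fin_cases i <;> fin_cases j <;> simp [sigmaZ, pow_two]
  rcases Nat.even_or_odd' m with ⟨k, rfl | rfl⟩
  · rw [pow_mul, h2, one_pow, natCast_two_mul_zmod, zero_mul, Matrix.one_apply, bitSign_zero]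
    exact if_congr (bitFin.injective.eq_iff.trans eq_comm) rfl rfl
  · rw [pow_add, pow_mul, h2, one_pow, pow_one, one_mul, Nat.cast_add, natCast_two_mul_zmod]
    rcases zmod_two_cases a with rfl | rfl <;> rcases zmod_two_cases b with rfl | rfl <;>
      simp [sigmaZ, bitFin_zero, bitFin_one, bitSign]

section TensorOp

variable {ι : Type*}

/-- The amplitude of a state on a bit string. -/
def amp (ψ : QubitSpace ι) (x : ι → ZMod 2) : ℂ := ψ (bitEquiv ι x)

theorem amp_smul (c : ℂ) (ψ : QubitSpace ι) (x : ι → ZMod 2) : amp (c • ψ) x = c * amp ψ x := rfl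

theorem amp_sum {κ : Type*} (s : Finset κ) (ψ : κ → QubitSpace ι) (x : ι → ZMod 2) :
    amp (∑ k ∈ s, ψ k) x = ∑ k ∈ s, amp (ψ k) x := by
  unfold amp
  simp

theorem amp_ext {ψ φ : QubitSpace ι} (h : ∀ x, amp ψ x = amp φ x) : ψ = φ := by
  ext s
  simpa [amp] using h ((bitEquiv ι).symm s)

variable [Fintype ι]

theorem norm_sq_eq_sum_amp [DecidableEq ι] (ψ : QubitSpace ι) :
    ‖ψ‖ ^ 2 = ∑ x : ι → ZMod 2, ‖amp ψ x‖ ^ 2 := by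
  rw [EuclideanSpace.norm_sq_eq]
  exact (Fintype.sum_equiv (bitEquiv ι) _ _ fun x => rfl).symm

theorem amp_tensorOp [DecidableEq ι] (O : ι → Matrix (Fin 2) (Fin 2) ℂ) (ψ : QubitSpace ι)
    (x : ι → ZMod 2) :
    amp (tensorOp O ψ) x =
      ∑ y : ι → ZMod 2, (∏ i, O i (bitFin (x i)) (bitFin (y i))) * amp ψ y := by
  have : amp (tensorOp O ψ) x =
      ∑ y : QubitConfig ι, (∏ i, O i (bitEquiv ι x i) (y i)) * ψ y := rfl
  rw [this]
  exact (Fintype.sum_equiv (bitEquiv ι) _ _ fun x => rfl).symm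

theorem amp_tensorOp_sigmaX_pow (m : ι → ℕ) (ψ : QubitSpace ι) (x : ι → ZMod 2) :
    amp (tensorOp (fun i => sigmaX ^ m i) ψ) x = amp ψ (x + fun i => (m i : ZMod 2)) := by
  classical
  rw [amp_tensorOp, Finset.sum_eq_single (x + fun i => (m i : ZMod 2))]
  · rw [Finset.prod_eq_one, one_mul]
    intro i _
    exact (sigmaX_pow_apply _ _ _).trans (if_pos rfl)
  · intro y _ hy
    obtain ⟨i, hi⟩ := Function.ne_iff.1 hy
    rw [Finset.prod_eq_zero (Finset.mem_univ i), zero_mul]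
    exact (sigmaX_pow_apply _ _ _).trans (if_neg hi)
  · exact fun h => absurd (Finset.mem_univ _) h

theorem amp_tensorOp_sigmaZ_pow (m : ι → ℕ) (ψ : QubitSpace ι) (x : ι → ZMod 2) :
    amp (tensorOp (fun i => sigmaZ ^ m i) ψ) x = bitSign (∑ i, (m i : ZMod 2) * x i) * amp ψ x := by
  classical
  rw [amp_tensorOp, Finset.sum_eq_single x, bitSign_sum]
  · congr 1
    exact Finset.prod_congr rfl fun i _ => by rw [sigmaZ_pow_apply, if_pos rfl]
  · intro y _ hy
    obtain ⟨i, hi⟩ := Function.ne_iff.1 hy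
    rw [Finset.prod_eq_zero (Finset.mem_univ i), zero_mul]
    rw [sigmaZ_pow_apply, if_neg hi]
  · exact fun h => absurd (Finset.mem_univ _) h

end TensorOp

/-! ### Stabilised states and ground states -/

namespace SurfaceMap

section GroundStates

open scoped Classical

variable {D : Type*} [Fintype D] (M : SurfaceMap D)

theorem vertexMult_eq_cob (v : M.Vertex) (i : M.Edge) :
    (M.vertexMult v i : ZMod 2) = M.cob (Pi.single v 1) i := by
  rw [vertexMult, Nat.card_eq_fintype_card, Fintype.card_subtype, cob_apply]
  simp [Pi.single_apply, Finset.filter_filter, and_comm]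

theorem sum_faceMult_mul (p : M.Face) (x : M.Edge → ZMod 2) :
    ∑ i, (M.faceMult p i : ZMod 2) * x i = M.bd x p := by
  rw [bd_apply, ← Finset.sum_fiberwise _ M.edgeOf]
  refine Finset.sum_congr rfl fun i _ => ?_
  rw [faceMult, Nat.card_eq_fintype_card, Fintype.card_subtype, Finset.filter_filter,
    Finset.sum_congr rfl (g := fun _ => x i) fun d hd => by rw [(Finset.mem_filter.1 hd).2.2]]
  simp

theorem amp_starOp (v : M.Vertex) (ψ : QubitSpace M.Edge) (x : M.Edge → ZMod 2) :
    amp (M.starOp v ψ) x = amp ψ (x + M.cob (Pi.single v 1)) := by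
  rw [starOp, amp_tensorOp_sigmaX_pow]
  simp only [vertexMult_eq_cob]

theorem amp_plaquetteOp (p : M.Face) (ψ : QubitSpace M.Edge) (x : M.Edge → ZMod 2) :
    amp (M.plaquetteOp p ψ) x = bitSign (M.bd x p) * amp ψ x := by
  rw [plaquetteOp, amp_tensorOp_sigmaZ_pow, sum_faceMult_mul]

theorem norm_starOp (v : M.Vertex) (ψ : QubitSpace M.Edge) : ‖M.starOp v ψ‖ = ‖ψ‖ := by
  rw [← sq_eq_sq₀ (norm_nonneg _) (norm_nonneg _), norm_sq_eq_sum_amp, norm_sq_eq_sum_amp]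
  exact Fintype.sum_equiv (Equiv.addRight (M.cob (Pi.single v 1)))
    (fun x => ‖amp (M.starOp v ψ) x‖ ^ 2) (fun x => ‖amp ψ x‖ ^ 2)
    fun x => congrArg (‖·‖ ^ 2) (M.amp_starOp v ψ x)

theorem norm_plaquetteOp (p : M.Face) (ψ : QubitSpace M.Edge) : ‖M.plaquetteOp p ψ‖ = ‖ψ‖ := by
  rw [← sq_eq_sq₀ (norm_nonneg _) (norm_nonneg _), norm_sq_eq_sum_amp, norm_sq_eq_sum_amp]
  simp [amp_plaquetteOp, norm_bitSign]

/-- The states stabilised by all star and plaquette operators, in terms of amplitudes. -/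
structure IsStabilized (ψ : QubitSpace M.Edge) : Prop where
  amp_add_cob : ∀ x φ, amp ψ (x + M.cob φ) = amp ψ x
  bd_eq_zero : ∀ x, amp ψ x ≠ 0 → M.bd x = 0

variable {M}

theorem IsStabilized.starOp_eq {ψ : QubitSpace M.Edge} (h : M.IsStabilized ψ) (v : M.Vertex) :
    M.starOp v ψ = ψ :=
  amp_ext fun x => by rw [amp_starOp, h.amp_add_cob]

theorem IsStabilized.plaquetteOp_eq {ψ : QubitSpace M.Edge} (h : M.IsStabilized ψ) (p : M.Face) :
    M.plaquetteOp p ψ = ψ := amp_ext fun x => by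
  rw [amp_plaquetteOp]
  by_cases hx : amp ψ x = 0
  · rw [hx, mul_zero]
  · rw [h.bd_eq_zero x hx, Pi.zero_apply, bitSign_zero, one_mul]

theorem isStabilized_of_eq {ψ : QubitSpace M.Edge} (hs : ∀ v, M.starOp v ψ = ψ)
    (hp : ∀ p, M.plaquetteOp p ψ = ψ) : M.IsStabilized ψ where
  amp_add_cob x φ := by
    induction φ using Pi.single_induction generalizing x with
    | zero => simp
    | add φ φ' h h' => rw [map_add, ← add_assoc, h', h]
    | single v a =>
      rcases zmod_two_cases a with rfl | rfl
      · simp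
      · rw [← amp_starOp, hs]
  bd_eq_zero x hx := by
    ext p
    by_contra hb
    have h1 := M.amp_plaquetteOp p ψ x
    rw [hp, bitSign_of_ne_zero hb] at h1
    exact hx (by linear_combination h1 / 2)

variable (M)

theorem hamiltonian_apply_of_isStabilized {ψ : QubitSpace M.Edge} (h : M.IsStabilized ψ)
    (U J : ℝ) : M.hamiltonian U J ψ =
      ((-(U * Fintype.card M.Vertex) - J * Fintype.card M.Face : ℝ) : ℂ) • ψ := by
  simp only [hamiltonian, LinearMap.sub_apply, LinearMap.neg_apply, LinearMap.smul_apply,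
    LinearMap.sum_apply, h.starOp_eq, h.plaquetteOp_eq, Finset.sum_const, Finset.card_univ]
  push_cast
  module

/-- Equality case of Cauchy–Schwarz, read off from the expansion of `‖x - y‖ ^ 2`. -/
theorem eq_of_norm_eq_of_re_inner {V : Type*} [NormedAddCommGroup V] [InnerProductSpace ℂ V]
    {x y : V} (hxy : ‖y‖ = ‖x‖) (h : ‖x‖ ^ 2 ≤ (inner ℂ x y).re) : y = x := by
  have h1 := norm_sub_sq (𝕜 := ℂ) x y
  rw [hxy] at h1
  change _ = _ - 2 * (inner ℂ x y).re + _ at h1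
  have h2 : ‖x - y‖ ^ 2 = 0 := le_antisymm (by linarith) (sq_nonneg _)
  rw [pow_eq_zero_iff two_ne_zero, norm_eq_zero, sub_eq_zero] at h2
  exact h2.symm

theorem re_inner_le_of_norm_eq {V : Type*} [NormedAddCommGroup V] [InnerProductSpace ℂ V]
    {x y : V} (hxy : ‖y‖ = ‖x‖) : (inner ℂ x y).re ≤ ‖x‖ ^ 2 :=
  (re_inner_le_norm (𝕜 := ℂ) x y).trans (by rw [hxy, sq])

/-- Since some state is stabilised, every ground state is. -/
theorem IsGroundState.isStabilized {U J : ℝ} (hU : 0 < U) (hJ : 0 < J) {ψ : QubitSpace M.Edge}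
    (h : M.IsGroundState U J ψ) {ψ' : QubitSpace M.Edge} (h' : M.IsStabilized ψ') (h0 : ψ' ≠ 0) :
    M.IsStabilized ψ := by
  obtain ⟨hn, E, ⟨hE, -⟩, hmin⟩ := h
  have hle := hmin _ (Module.End.hasEigenvalue_of_hasEigenvector
    (Module.End.hasEigenvector_iff.2
      ⟨Module.End.mem_eigenspace_iff.2 (M.hamiltonian_apply_of_isStabilized h' U J), h0⟩))
  rw [Module.End.mem_eigenspace_iff] at hE
  have h1 : (inner ℂ ψ (M.hamiltonian U J ψ)).re = E := by
    rw [hE, inner_smul_right, inner_self_eq_norm_sq_to_K, hn]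
    simp
  have h2 : (inner ℂ ψ (M.hamiltonian U J ψ)).re =
      -(U * ∑ v, (inner ℂ ψ (M.starOp v ψ)).re) - J * ∑ p, (inner ℂ ψ (M.plaquetteOp p ψ)).re := by
    simp only [hamiltonian, LinearMap.sub_apply, LinearMap.neg_apply, LinearMap.smul_apply,
      LinearMap.sum_apply, inner_sub_right, inner_neg_right, inner_smul_right, inner_sum,
      Complex.sub_re, Complex.neg_re, Complex.re_ofReal_mul, Complex.re_sum]
  -- Every stabiliser has expectation at most 1. As `E` is no larger than the energy of the
  -- stabilised state and `U`, `J` are positive, all these bounds are equalities.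
  have hs : ∀ v ∈ Finset.univ, (inner ℂ ψ (M.starOp v ψ)).re ≤ 1 := fun v _ => by
    simpa [hn] using re_inner_le_of_norm_eq (M.norm_starOp v ψ)
  have hp : ∀ p ∈ Finset.univ, (inner ℂ ψ (M.plaquetteOp p ψ)).re ≤ 1 := fun p _ => by
    simpa [hn] using re_inner_le_of_norm_eq (M.norm_plaquetteOp p ψ)
  have hs1 : ∑ v, (inner ℂ ψ (M.starOp v ψ)).re ≤ Fintype.card M.Vertex := by
    simpa using Finset.sum_le_sum hs
  have hp1 : ∑ p, (inner ℂ ψ (M.plaquetteOp p ψ)).re ≤ Fintype.card M.Face := by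
    simpa using Finset.sum_le_sum hp
  have hs2 := mul_le_mul_of_nonneg_left hs1 hU.le
  have hp2 := mul_le_mul_of_nonneg_left hp1 hJ.le
  have hs3 : ∑ v, (inner ℂ ψ (M.starOp v ψ)).re = ∑ v : M.Vertex, (1 : ℝ) := by
    simpa using mul_left_cancel₀ hU.ne' (le_antisymm hs2 (by linarith))
  have hp3 : ∑ p, (inner ℂ ψ (M.plaquetteOp p ψ)).re = ∑ p : M.Face, (1 : ℝ) := by
    simpa using mul_left_cancel₀ hJ.ne' (le_antisymm hp2 (by linarith))
  refine isStabilized_of_eq (fun v => ?_) fun p => ?_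
  · refine eq_of_norm_eq_of_re_inner (M.norm_starOp v ψ) ?_
    rw [(Finset.sum_eq_sum_iff_of_le hs).1 hs3 v (Finset.mem_univ v), hn, one_pow]
  · refine eq_of_norm_eq_of_re_inner (M.norm_plaquetteOp p ψ) ?_
    rw [(Finset.sum_eq_sum_iff_of_le hp).1 hp3 p (Finset.mem_univ p), hn, one_pow]

end GroundStates

end SurfaceMap

/-! ### The loop state is stabilised -/

namespace SurfaceMap

section LoopState

open scoped Classical

variable {D : Type*} [Fintype D] (M : SurfaceMap D)

theorem amp_plusState (ι : Type*) [Fintype ι] (x : ι → ZMod 2) :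
    amp (plusState ι) x = ∏ _i : ι, ((Real.sqrt 2 : ℝ) : ℂ)⁻¹ := rfl

theorem amp_loopOp (c : Finset M.Edge) (ψ : QubitSpace M.Edge) (x : M.Edge → ZMod 2) :
    amp (M.loopOp c ψ) x = bitSign (∑ i ∈ c, x i) * amp ψ x := by
  have h : M.loopOp c = tensorOp fun i => sigmaZ ^ (if i ∈ c then 1 else 0) := by
    unfold loopOp
    congr 1
    ext1 i
    split_ifs <;> simp
  rw [h, amp_tensorOp_sigmaZ_pow]
  simp

theorem amp_loopSum (x : M.Edge → ZMod 2) :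
    amp M.loopSum x = (∑ c : Finset M.Edge with M.IsLoop c, bitSign (∑ i ∈ c, x i)) *
      ∏ _i : M.Edge, ((Real.sqrt 2 : ℝ) : ℂ)⁻¹ := by
  rw [loopSum, amp_sum, Finset.sum_mul]
  exact Finset.sum_congr rfl fun c _ => by rw [amp_loopOp, amp_plusState]

theorem isLoop_iff (c : Finset M.Edge) :
    M.IsLoop c ↔ ∀ v, ∑ i ∈ c, M.cob (Pi.single v 1) i = 0 := by
  refine forall_congr' fun v => ?_
  simp only [← vertexMult_eq_cob]
  rw [← Nat.cast_sum, ZMod.natCast_eq_zero_iff, even_iff_two_dvd]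

variable {M}

/-- Mod 2 cycles are orthogonal to gradients, which gives the star invariance of the loop sum. -/
theorem IsLoop.sum_cob {c : Finset M.Edge} (hc : M.IsLoop c) (φ : M.Vertex → ZMod 2) :
    ∑ i ∈ c, M.cob φ i = 0 := by
  induction φ using Pi.single_induction with
  | zero => simp
  | add φ φ' h h' => simp [Finset.sum_add_distrib, h, h']
  | single v a =>
    rcases zmod_two_cases a with rfl | rfl
    · simp
    · exact M.isLoop_iff c |>.1 hc v

theorem sum_symmDiff_zmod_two {ι : Type*} [Fintype ι] [DecidableEq ι] (s t : Finset ι) (f : ι → ZMod 2) :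
    ∑ i ∈ symmDiff s t, f i = ∑ i ∈ s, f i + ∑ i ∈ t, f i := by
  have h : ∀ u : Finset ι, ∑ i ∈ u, f i = ∑ i, if i ∈ u then f i else 0 := fun u => by simp
  rw [h, h s, h t, ← Finset.sum_add_distrib]
  refine Finset.sum_congr rfl fun i _ => ?_
  by_cases hs : i ∈ s <;> by_cases ht : i ∈ t <;>
    simp [Finset.mem_symmDiff, hs, ht, CharTwo.add_self_eq_zero]

variable (M)

/-- The edges on an odd number of sides of a face. -/
noncomputable def faceEdges (p : M.Face) : Finset M.Edge :=
  Finset.univ.filter fun i => (M.faceMult p i : ZMod 2) = 1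

theorem sum_faceEdges (p : M.Face) (f : M.Edge → ZMod 2) :
    ∑ i ∈ M.faceEdges p, f i = M.bd f p := by
  rw [← sum_faceMult_mul, faceEdges, Finset.sum_filter]
  refine Finset.sum_congr rfl fun i _ => ?_
  rcases zmod_two_cases (M.faceMult p i : ZMod 2) with h | h <;> simp [h]

theorem isLoop_symmDiff_faceEdges (p : M.Face) (c : Finset M.Edge) :
    M.IsLoop (symmDiff c (M.faceEdges p)) ↔ M.IsLoop c := by
  simp only [isLoop_iff, sum_symmDiff_zmod_two, sum_faceEdges, bd_cob, Pi.zero_apply, add_zero]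

/-- At the zero string all signs are 1, so the sum counts loops, among them the empty one. -/
theorem amp_loopSum_zero_ne_zero : amp M.loopSum 0 ≠ 0 := by
  rw [amp_loopSum]
  refine mul_ne_zero ?_ (Finset.prod_ne_zero_iff.2 fun i _ => by simp)
  simp only [Pi.zero_apply, Finset.sum_const_zero, bitSign_zero, Finset.sum_const, nsmul_eq_mul,
    mul_one, Nat.cast_ne_zero]
  refine (Finset.card_pos.2 ⟨∅, ?_⟩).ne'
  simp [isLoop_iff]

theorem loopSum_ne_zero : M.loopSum ≠ 0 := fun h =>
  M.amp_loopSum_zero_ne_zero (by rw [h]; rfl)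

theorem isStabilized_loopSum : M.IsStabilized M.loopSum where
  amp_add_cob x φ := by
    rw [amp_loopSum, amp_loopSum]
    congr 1
    refine Finset.sum_congr rfl fun c hc => ?_
    simp only [Pi.add_apply]
    rw [Finset.sum_add_distrib, (Finset.mem_filter.1 hc).2.sum_cob, add_zero]
  bd_eq_zero x hx := by
    ext p
    by_contra hb
    apply hx
    rw [amp_loopSum]
    -- Adding the boundary of `p` permutes the loops and flips every sign when the flux through `p`
    -- is nonzero, so the sum equals its own negative.
    have h : ∑ c : Finset M.Edge with M.IsLoop c, bitSign (∑ i ∈ c, x i) =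
        ∑ c : Finset M.Edge with M.IsLoop c, -bitSign (∑ i ∈ c, x i) := by
      refine Finset.sum_bij' (fun c _ => symmDiff c (M.faceEdges p))
        (fun c _ => symmDiff c (M.faceEdges p)) ?_ ?_ ?_ ?_ ?_
      · intro c hc
        simpa [isLoop_symmDiff_faceEdges] using hc
      · intro c hc
        simpa [isLoop_symmDiff_faceEdges] using hc
      · simp
      · simp
      · intro c _
        rw [sum_symmDiff_zmod_two, sum_faceEdges, bitSign_add, bitSign_of_ne_zero hb]
        ring
    rw [Finset.sum_neg_distrib] at h
    rw [show ∑ c : Finset M.Edge with M.IsLoop c, bitSign (∑ i ∈ c, x i) = 0 by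
      linear_combination h / 2, zero_mul]

theorem isStabilized_psiZero : M.IsStabilized M.psiZero where
  amp_add_cob x φ := by
    rw [psiZero, amp_smul, amp_smul, M.isStabilized_loopSum.amp_add_cob]
  bd_eq_zero x hx := by
    rw [psiZero, amp_smul] at hx
    exact M.isStabilized_loopSum.bd_eq_zero x (right_ne_zero_of_mul hx)

theorem norm_psiZero : ‖M.psiZero‖ = 1 :=
  norm_smul_inv_norm M.loopSum_ne_zero

end LoopState

end SurfaceMap

/-! ### Enumeration of even fluxes -/

section Labels

open scoped Classical

/-- The even subsets of a nonempty set of size `n` can be listed by `Fin (2 ^ (n - 1))`. -/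
theorem exists_enum_even {F : Type*} [Fintype F] {P : Set F} (hP : P.Nonempty)
    {n : ℕ} (hn : Nat.card P = n) : ∃ t : Fin (2 ^ (n - 1)) → F → ZMod 2,
      Function.Injective t ∧ ∀ u, (∃ k, t k = u) ↔ (∀ p ∉ P, u p = 0) ∧ ∑ p, u p = 0 := by
  subst hn
  obtain ⟨p₀, hp₀⟩ := hP
  -- The bits away from `p₀` are free, and parity determines the bit at `p₀`.
  let Q := {p : F // p ∈ P ∧ p ≠ p₀}
  have hcard : Fintype.card Q = Nat.card P - 1 := by
    have h1 : Nat.card P = P.toFinset.card := by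
      rw [Set.toFinset_card, Nat.card_eq_fintype_card]
    rw [h1, ← Finset.card_erase_of_mem (by simpa using hp₀ : p₀ ∈ P.toFinset), Fintype.card_subtype]
    congr 1
    ext p
    simp [and_comm]
  have hcard' : Fintype.card (Fin (2 ^ (Nat.card P - 1))) = Fintype.card (Q → ZMod 2) := by
    rw [Fintype.card_fin, Fintype.card_fun, ZMod.card, hcard]
  let e := Fintype.equivOfCardEq hcard'
  let v : (Q → ZMod 2) → F → ZMod 2 := fun w p =>
    if h : p ∈ P ∧ p ≠ p₀ then w ⟨p, h⟩ else if p = p₀ then ∑ q, w q else 0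
  have hvQ : ∀ w (q : Q), v w q = w q := fun w q => dif_pos q.2
  have hv0 : ∀ w, v w p₀ = ∑ q, w q := fun w => by simp [v]
  have hvP : ∀ w, ∀ p ∉ P, v w p = 0 := by
    intro w p hp
    have h1 : p ≠ p₀ := by rintro rfl; exact hp hp₀
    simp [v, hp, h1]
  have hsplit : ∀ u : F → ZMod 2, (∀ p ∉ P, u p = 0) → ∑ p, u p = u p₀ + ∑ q : Q, u q := by
    intro u hu
    rw [← Finset.add_sum_erase _ _ (Finset.mem_univ p₀)]
    congr 1
    rw [← Finset.sum_subtype (P.toFinset.erase p₀) (by simp [and_comm]) u]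
    symm
    refine Finset.sum_subset (Finset.erase_subset_erase _ (Finset.subset_univ _)) fun p hp hp' => ?_
    refine hu p fun h => hp' ?_
    rw [Finset.mem_erase] at hp ⊢
    exact ⟨hp.1, by simpa using h⟩
  refine ⟨fun k => v (e k), fun k k' h => e.injective (funext fun q => ?_), fun u => ⟨?_, ?_⟩⟩
  · exact (hvQ _ q).symm.trans ((congrFun h q).trans (hvQ _ q))
  · rintro ⟨k, rfl⟩
    refine ⟨hvP _, ?_⟩
    rw [hsplit _ (hvP _), hv0]
    simp only [hvQ]
    exact CharTwo.add_self_eq_zero _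
  · rintro ⟨hu, hs⟩
    refine ⟨e.symm fun q => u q, ?_⟩
    rw [hsplit u hu] at hs
    ext p
    simp only [Equiv.apply_symm_apply]
    by_cases hp : p = p₀
    · subst hp
      exact (hv0 _).trans (CharTwo.add_eq_zero.1 hs).symm
    · by_cases hP : p ∈ P
      · exact hvQ _ ⟨p, hP, hp⟩
      · exact (hvP _ _ hP).trans (hu p hP).symm

end Labels

/-! ### Uniform states and restriction to four regions -/

section States

open scoped Classical

variable {ι : Type*}

/-- The state with given amplitudes. -/
noncomputable def stateOfAmp (χ : (ι → ZMod 2) → ℂ) : QubitSpace ι :=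
  WithLp.toLp 2 fun s => χ ((bitEquiv ι).symm s)

theorem amp_stateOfAmp (χ : (ι → ZMod 2) → ℂ) (x : ι → ZMod 2) : amp (stateOfAmp χ) x = χ x := rfl

/-- The normalised equal-weight superposition of a set of bit strings. -/
noncomputable def uniformState (S : Set (ι → ZMod 2)) : QubitSpace ι :=
  stateOfAmp fun x => if x ∈ S then ((Real.sqrt (Nat.card S) : ℝ) : ℂ)⁻¹ else 0

theorem amp_uniformState (S : Set (ι → ZMod 2)) (x : ι → ZMod 2) :
    amp (uniformState S) x = if x ∈ S then ((Real.sqrt (Nat.card S) : ℝ) : ℂ)⁻¹ else 0 := rfl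

theorem mem_of_amp_uniformState_ne_zero {S : Set (ι → ZMod 2)} {x : ι → ZMod 2}
    (h : amp (uniformState S) x ≠ 0) : x ∈ S := by
  by_contra hx
  exact h (if_neg hx)

/-- Restriction of a bit string. -/
def bitRestrict (R : Set ι) : (ι → ZMod 2) →+ (R → ZMod 2) where
  toFun x i := x i
  map_zero' := rfl
  map_add' _ _ := rfl

theorem bitRestrict_apply (R : Set ι) (x : ι → ZMod 2) (i : R) : bitRestrict R x i = x i := rfl

/-- Extension of a bit string by zero. -/
noncomputable def extendZero (R : Set ι) : (R → ZMod 2) →+ (ι → ZMod 2) where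
  toFun a i := if h : i ∈ R then a ⟨i, h⟩ else 0
  map_zero' := by ext; simp
  map_add' a b := by
    ext i
    by_cases h : i ∈ R <;> simp [h]

theorem extendZero_apply_of_notMem {R : Set ι} (a : R → ZMod 2) {i : ι} (hi : i ∉ R) :
    extendZero R a i = 0 := dif_neg hi

theorem extendZero_restrict {R : Set ι} (x : ι → ZMod 2) :
    extendZero R (bitRestrict R x) = R.indicator x := by
  ext i
  by_cases h : i ∈ R <;> simp [extendZero, h, bitRestrict_apply]

theorem extendZero_restrict_of_support {R : Set ι} {x : ι → ZMod 2} (hx : ∀ i ∉ R, x i = 0) :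
    extendZero R (bitRestrict R x) = x := by
  rw [extendZero_restrict, Set.indicator_eq_self]
  exact fun i hi => by_contra fun h => hi (hx i h)

/-- Four disjoint sets covering everything. -/
structure IsFourPartition (A₁ A₂ B₁ B₂ : Set ι) : Prop where
  cover : ∀ i, i ∈ A₁ ∨ i ∈ A₂ ∨ i ∈ B₁ ∨ i ∈ B₂
  not₁₂ : ∀ i ∈ A₁, i ∉ A₂
  not₁₃ : ∀ i ∈ A₁, i ∉ B₁
  not₁₄ : ∀ i ∈ A₁, i ∉ B₂
  not₂₃ : ∀ i ∈ A₂, i ∉ B₁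
  not₂₄ : ∀ i ∈ A₂, i ∉ B₂
  not₃₄ : ∀ i ∈ B₁, i ∉ B₂

variable {A₁ A₂ B₁ B₂ : Set ι}

theorem IsFourPartition.eq_add (h : IsFourPartition A₁ A₂ B₁ B₂) (x : ι → ZMod 2) :
    x = extendZero A₁ (bitRestrict A₁ x) + extendZero A₂ (bitRestrict A₂ x) +
      extendZero B₁ (bitRestrict B₁ x) + extendZero B₂ (bitRestrict B₂ x) := by
  ext i
  simp only [extendZero_restrict, Pi.add_apply]
  have h1 := h.not₁₂ i
  have h2 := h.not₁₃ i
  have h3 := h.not₁₄ i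
  have h4 := h.not₂₃ i
  have h5 := h.not₂₄ i
  have h6 := h.not₃₄ i
  rcases h.cover i with hi | hi | hi | hi <;> simp_all [Set.indicator]

theorem IsFourPartition.bijective (h : IsFourPartition A₁ A₂ B₁ B₂) :
    Function.Bijective fun x : ι → ZMod 2 =>
      (bitRestrict A₁ x, bitRestrict A₂ x, bitRestrict B₁ x, bitRestrict B₂ x) := by
  refine ⟨fun x y hxy => ?_, fun ⟨a₁, a₂, b₁, b₂⟩ => ⟨extendZero A₁ a₁ + extendZero A₂ a₂ +
    extendZero B₁ b₁ + extendZero B₂ b₂, ?_⟩⟩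
  · simp only [Prod.mk.injEq] at hxy
    rw [h.eq_add x, h.eq_add y, hxy.1, hxy.2.1, hxy.2.2.1, hxy.2.2.2]
  · simp only [Prod.mk.injEq]
    refine ⟨?_, ?_, ?_, ?_⟩ <;> ext ⟨i, hi⟩ <;>
    · have h1 := h.not₁₂ i
      have h2 := h.not₁₃ i
      have h3 := h.not₁₄ i
      have h4 := h.not₂₃ i
      have h5 := h.not₂₄ i
      have h6 := h.not₃₄ i
      simp_all [extendZero, bitRestrict_apply]

variable [Fintype ι]

theorem sum_ite_mem_eq_card {α : Type*} [Fintype α] (S : Set α) :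
    ∑ x, (if x ∈ S then (1 : ℝ) else 0) = Nat.card S := by
  rw [Finset.sum_boole, Nat.card_eq_fintype_card, Fintype.card_subtype]

theorem norm_uniformState {S : Set (ι → ZMod 2)} (hS : S.Nonempty) : ‖uniformState S‖ = 1 := by
  have : Nonempty S := hS.to_subtype
  have h0 : (0 : ℝ) < Nat.card S := Nat.cast_pos.2 Nat.card_pos
  rw [← sq_eq_sq₀ (norm_nonneg _) zero_le_one, norm_sq_eq_sum_amp]
  have : ∀ x, ‖amp (uniformState S) x‖ ^ 2 = (Nat.card S : ℝ)⁻¹ * if x ∈ S then 1 else 0 := by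
    intro x
    rw [amp_uniformState]
    split_ifs
    · rw [norm_inv, Complex.norm_real, Real.norm_eq_abs, inv_pow, sq_abs, Real.sq_sqrt h0.le,
        mul_one]
    · simp
  simp only [this]
  rw [← Finset.mul_sum, sum_ite_mem_eq_card, inv_mul_cancel₀ h0.ne', one_pow]

theorem orthonormal_of_disjoint_supports {κ : Type*} {u : κ → QubitSpace ι} (hn : ∀ k, ‖u k‖ = 1)
    (hd : ∀ k k' x, amp (u k) x ≠ 0 → amp (u k') x ≠ 0 → k = k') : Orthonormal ℂ u := by
  refine ⟨hn, fun k k' hk => ?_⟩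
  change inner ℂ (u k) (u k') = 0
  rw [PiLp.inner_apply]
  refine Finset.sum_eq_zero fun s _ => ?_
  by_cases h : u k s = 0
  · rw [h, inner_zero_left]
  by_cases h' : u k' s = 0
  · rw [h', inner_zero_right]
  exact absurd (hd k k' ((bitEquiv ι).symm s) h h') hk

theorem IsFourPartition.sum_mul [DecidableEq ι] (h : IsFourPartition A₁ A₂ B₁ B₂)
    (p : (A₁ → ZMod 2) → ℝ) (q : (A₂ → ZMod 2) → ℝ) (r : (B₁ → ZMod 2) → ℝ)
    (s : (B₂ → ZMod 2) → ℝ) :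
    ∑ x, p (bitRestrict A₁ x) * q (bitRestrict A₂ x) * r (bitRestrict B₁ x) * s (bitRestrict B₂ x) =
      (∑ a, p a) * (∑ a, q a) * (∑ b, r b) * ∑ b, s b := by
  rw [h.bijective.sum_comp fun y => p y.1 * q y.2.1 * r y.2.2.1 * s y.2.2.2]
  simp only [Fintype.sum_prod_type, ← Finset.mul_sum, ← Finset.sum_mul]

end States

/-! ### From block structure of amplitudes to a nested sum -/

section NestedSum

open scoped Classical

/-- A normalised state with product structure on labelled blocks of bit strings is a nested sum over
uniform states. -/
theorem exists_isNestedSum {D : Type*} [Fintype D] {M : SurfaceMap D} {A₁ A₂ B₁ B₂ : Set M.Edge}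
    (hP : IsFourPartition A₁ A₂ B₁ B₂) {m n k cF cG cH : ℕ}
    {F : Fin m → Fin n → Set (A₁ → ZMod 2)} {G : Fin n → Set (A₂ → ZMod 2)}
    {H : Fin k → Set (B₂ → ZMod 2)} {χ : Fin m → Fin k → (B₁ → ZMod 2) → ℂ}
    (hcF : ∀ μ ν, Nat.card (F μ ν) = cF) (hcG : ∀ ν, Nat.card (G ν) = cG)
    (hcH : ∀ τ, Nat.card (H τ) = cH)
    (hF : ∀ μ ν μ' ν' a, a ∈ F μ ν → a ∈ F μ' ν' → μ = μ' ∧ ν = ν')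
    (hH : ∀ τ τ' b, b ∈ H τ → b ∈ H τ' → τ = τ')
    (hχ : ∀ μ τ μ' τ' b, χ μ τ b ≠ 0 → χ μ' τ' b ≠ 0 → μ = μ' ∧ τ = τ')
    {K : ℝ} (hK : ∀ μ τ, ∑ b, ‖χ μ τ b‖ ^ 2 = K)
    {ψ : QubitSpace M.Edge} (hψ : ‖ψ‖ = 1)
    (hblock : ∀ x μ ν τ, bitRestrict A₁ x ∈ F μ ν → bitRestrict A₂ x ∈ G ν → bitRestrict B₂ x ∈ H τ →
      amp ψ x = χ μ τ (bitRestrict B₁ x))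
    (hsupp : ∀ x, amp ψ x ≠ 0 → ∃ μ ν τ, bitRestrict A₁ x ∈ F μ ν ∧ bitRestrict A₂ x ∈ G ν ∧
      bitRestrict B₂ x ∈ H τ) :
    ∃ f : Fin m → Fin k → QubitSpace B₁,
      Orthonormal ℂ (fun p : Fin m × Fin k => f p.1 p.2) ∧
      SurfaceMap.IsNestedSum (fun μ ν => uniformState (F μ ν)) (fun ν => uniformState (G ν)) f
        (fun τ => uniformState (H τ)) ψ := by
  -- The blocks are disjoint, so at most one triple of labels contributes to a given string.
  have hsq : ∀ x, ‖amp ψ x‖ ^ 2 = ∑ μ, ∑ ν, ∑ τ,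
      (if bitRestrict A₁ x ∈ F μ ν then (1 : ℝ) else 0) * (if bitRestrict A₂ x ∈ G ν then 1 else 0) *
        ‖χ μ τ (bitRestrict B₁ x)‖ ^ 2 * (if bitRestrict B₂ x ∈ H τ then 1 else 0) := by
    intro x
    by_cases hx : ∃ μ ν τ, bitRestrict A₁ x ∈ F μ ν ∧ bitRestrict A₂ x ∈ G ν ∧ bitRestrict B₂ x ∈ H τ
    · obtain ⟨μ, ν, τ, h1, h2, h3⟩ := hx
      rw [Finset.sum_eq_single μ, Finset.sum_eq_single ν, Finset.sum_eq_single τ,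
        hblock x μ ν τ h1 h2 h3, if_pos h1, if_pos h2, if_pos h3]
      · ring
      · intro τ' _ hne
        rw [if_neg fun h => hne (hH _ _ _ h h3), mul_zero]
      · simp
      · intro ν' _ hne
        rw [if_neg fun h => hne (hF _ _ _ _ _ h h1).2]
        simp
      · simp
      · intro μ' _ hne
        refine Finset.sum_eq_zero fun ν' _ => ?_
        rw [if_neg fun h => hne (hF _ _ _ _ _ h h1).1]
        simp
      · simp
    · rw [by_contra fun h => hx (hsupp x h), norm_zero, zero_pow two_ne_zero]
      symm
      refine Finset.sum_eq_zero fun μ _ => Finset.sum_eq_zero fun ν _ =>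
        Finset.sum_eq_zero fun τ _ => ?_
      by_contra h
      refine hx ⟨μ, ν, τ, ?_, ?_, ?_⟩ <;> by_contra h' <;> simp [h'] at h
  -- Normalisation has two uses: it shows that none of the counts is zero, and it gives the scale
  -- that makes the vectors `f` unit.
  have hnorm : (m * n * k * cF * cG * cH : ℝ) * K = 1 := by
    have h1 := norm_sq_eq_sum_amp ψ
    rw [hψ, one_pow] at h1
    rw [h1]
    simp only [hsq]
    have hsum : ∑ x, ∑ μ, ∑ ν, ∑ τ,
        (if bitRestrict A₁ x ∈ F μ ν then (1 : ℝ) else 0) *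
          (if bitRestrict A₂ x ∈ G ν then 1 else 0) * ‖χ μ τ (bitRestrict B₁ x)‖ ^ 2 *
          (if bitRestrict B₂ x ∈ H τ then 1 else 0) =
        ∑ _μ : Fin m, ∑ _ν : Fin n, ∑ _τ : Fin k, (cF * cG * K * cH : ℝ) := by
      rw [Finset.sum_comm]
      refine Finset.sum_congr rfl fun μ _ => ?_
      rw [Finset.sum_comm]
      refine Finset.sum_congr rfl fun ν _ => ?_
      rw [Finset.sum_comm]
      refine Finset.sum_congr rfl fun τ _ => ?_
      rw [hP.sum_mul (fun a => if a ∈ F μ ν then (1 : ℝ) else 0)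
        (fun a => if a ∈ G ν then (1 : ℝ) else 0) (fun b => ‖χ μ τ b‖ ^ 2)
        (fun b => if b ∈ H τ then (1 : ℝ) else 0), sum_ite_mem_eq_card, sum_ite_mem_eq_card,
        sum_ite_mem_eq_card, hcF, hcG, hcH, hK]
    rw [hsum]
    simp only [Finset.sum_const, Finset.card_univ, Fintype.card_fin, nsmul_eq_mul]
    ring
  have hpos : ∀ a : ℕ, (a : ℝ) ≠ 0 → ((Real.sqrt a : ℝ) : ℂ) ≠ 0 := fun a ha => by
    rw [Complex.ofReal_ne_zero, Real.sqrt_ne_zero']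
    exact lt_of_le_of_ne (Nat.cast_nonneg a) ha.symm
  have hne := left_ne_zero_of_mul (hnorm.trans_ne one_ne_zero)
  simp only [ne_eq, mul_eq_zero, not_or] at hne
  obtain ⟨⟨⟨⟨⟨hm, hn⟩, hk⟩, hcF0⟩, hcG0⟩, hcH0⟩ := hne
  -- `C` cancels the three prefactors and the normalisations of the three uniform states.
  let C : ℂ := (Real.sqrt m : ℝ) * (Real.sqrt n : ℝ) * (Real.sqrt k : ℝ) * (Real.sqrt cF : ℝ) *
    (Real.sqrt cG : ℝ) * (Real.sqrt cH : ℝ)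
  have hC : ‖C‖ ^ 2 = m * n * k * cF * cG * cH := by
    simp only [C, norm_mul, Complex.norm_real, Real.norm_eq_abs, mul_pow, sq_abs,
      Real.sq_sqrt (Nat.cast_nonneg _)]
  refine ⟨fun μ τ => stateOfAmp fun b => C * χ μ τ b, ?_, fun s => ?_⟩
  · refine orthonormal_of_disjoint_supports (fun p => ?_) fun p p' b h h' => ?_
    · rw [← sq_eq_sq₀ (norm_nonneg _) zero_le_one, norm_sq_eq_sum_amp]
      simp only [amp_stateOfAmp, norm_mul, mul_pow]
      rw [← Finset.mul_sum, hK, hC, hnorm, one_pow]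
    · have := hχ _ _ _ _ b (right_ne_zero_of_mul h) (right_ne_zero_of_mul h')
      exact Prod.ext this.1 this.2
  · obtain ⟨x, rfl⟩ := (bitEquiv M.Edge).surjective s
    change amp ψ x = ((Real.sqrt m : ℝ) : ℂ)⁻¹ * ∑ μ, (((Real.sqrt n : ℝ) : ℂ)⁻¹ *
      ∑ ν, amp (uniformState (F μ ν)) (bitRestrict A₁ x) * amp (uniformState (G ν)) (bitRestrict A₂ x)) *
      (((Real.sqrt k : ℝ) : ℂ)⁻¹ * ∑ τ, C * χ μ τ (bitRestrict B₁ x) *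
        amp (uniformState (H τ)) (bitRestrict B₂ x))
    by_cases hx : ∃ μ ν τ, bitRestrict A₁ x ∈ F μ ν ∧ bitRestrict A₂ x ∈ G ν ∧ bitRestrict B₂ x ∈ H τ
    · obtain ⟨μ, ν, τ, h1, h2, h3⟩ := hx
      rw [Finset.sum_eq_single μ, Finset.sum_eq_single ν, Finset.sum_eq_single τ,
        hblock x μ ν τ h1 h2 h3]
      · simp only [amp_uniformState, if_pos h1, if_pos h2, if_pos h3, hcF, hcG, hcH, C]
        field_simp [hpos _ hm, hpos _ hn, hpos _ hk, hpos _ hcF0, hpos _ hcG0, hpos _ hcH0]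
      · intro τ' _ hne
        rw [amp_uniformState (H τ'), if_neg fun h => hne (hH _ _ _ h h3), mul_zero]
      · simp
      · intro ν' _ hne
        rw [amp_uniformState (F μ ν'), if_neg fun h => hne (hF _ _ _ _ _ h h1).2, zero_mul]
      · simp
      · intro μ' _ hne
        rw [Finset.sum_eq_zero, mul_zero, zero_mul]
        intro ν' _
        rw [amp_uniformState (F μ' ν'), if_neg fun h => hne (hF _ _ _ _ _ h h1).1, zero_mul]
      · simp
    · rw [by_contra fun h => hx (hsupp x h)]
      symm
      rw [Finset.sum_eq_zero, mul_zero]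
      intro μ _
      by_contra h
      obtain ⟨ν, -, h1⟩ := Finset.exists_ne_zero_of_sum_ne_zero
        (right_ne_zero_of_mul (left_ne_zero_of_mul h))
      obtain ⟨τ, -, h2⟩ := Finset.exists_ne_zero_of_sum_ne_zero
        (right_ne_zero_of_mul (right_ne_zero_of_mul h))
      exact hx ⟨μ, ν, τ, mem_of_amp_uniformState_ne_zero (left_ne_zero_of_mul h1),
        mem_of_amp_uniformState_ne_zero (right_ne_zero_of_mul h1),
        mem_of_amp_uniformState_ne_zero (right_ne_zero_of_mul h2)⟩

end NestedSum

/-! ### Fluxes of nested regions and the decomposition -/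

namespace SurfaceMap

section Regions

open scoped Classical

variable {D : Type*} {M : SurfaceMap D}

theorem faceMeets_union {p : M.Face} {R S : Set M.Edge} :
    M.FaceMeets p (R ∪ S) ↔ M.FaceMeets p R ∨ M.FaceMeets p S := by
  constructor
  · rintro ⟨d, h, hR | hS⟩
    exacts [Or.inl ⟨d, h, hR⟩, Or.inr ⟨d, h, hS⟩]
  · rintro (⟨d, h, hR⟩ | ⟨d, h, hS⟩)
    exacts [⟨d, h, Or.inl hR⟩, ⟨d, h, Or.inr hS⟩]

/-- Distinct borders have no plaquette in common, so two labels can be read off from the sum of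
their fluxes. -/
theorem eq_of_add_eq_add_of_disjoint_support {F : Type*} {P Q : Set F} (hPQ : ∀ p ∈ P, p ∉ Q)
    {u u' v v' : F → ZMod 2} (hu : ∀ p ∉ P, u p = 0) (hu' : ∀ p ∉ P, u' p = 0)
    (hv : ∀ p ∉ Q, v p = 0) (hv' : ∀ p ∉ Q, v' p = 0) (h : u + v = u' + v') :
    u = u' ∧ v = v' := by
  have h1 : u = u' := by
    ext p
    by_cases hp : p ∈ P
    · have h2 := congrFun h p
      rwa [Pi.add_apply, Pi.add_apply, hv p (hPQ p hp), hv' p (hPQ p hp), add_zero, add_zero] at h2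
    · rw [hu p hp, hu' p hp]
  subst h1
  exact ⟨rfl, add_left_cancel h⟩

theorem add_self_zmod_two {F : Type*} (u : F → ZMod 2) : u + u = 0 :=
  funext fun _ => CharTwo.add_self_eq_zero _

/-- Nested contractible regions: `A₂` deep inside `A₁ ∪ A₂`, and `B₂` deep inside its complement. -/
structure NestedRegions (M : SurfaceMap D) (A₁ A₂ B₁ B₂ : Set M.Edge) : Prop where
  part : IsFourPartition A₁ A₂ B₁ B₂
  contractible : M.IsContractible (A₁ ∪ A₂)
  contractible_left : M.IsContractible A₂
  contractible_right : M.IsContractible B₂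
  left_border : ¬ M.ShareBorder A₂ (B₁ ∪ B₂)
  right_border : ¬ M.ShareBorder B₂ (A₁ ∪ A₂)

namespace NestedRegions

variable {A₁ A₂ B₁ B₂ : Set M.Edge}

theorem face_left (h : M.NestedRegions A₁ A₂ B₁ B₂) {p : M.Face} (hp : M.FaceMeets p A₂) :
    ¬ M.FaceMeets p B₁ ∧ ¬ M.FaceMeets p B₂ := by
  rw [← not_or, ← faceMeets_union]
  exact fun h' => h.left_border (Or.inr ⟨p, hp, h'⟩)

theorem face_right (h : M.NestedRegions A₁ A₂ B₁ B₂) {p : M.Face} (hp : M.FaceMeets p B₂) :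
    ¬ M.FaceMeets p A₁ ∧ ¬ M.FaceMeets p A₂ := by
  rw [← not_or, ← faceMeets_union]
  exact fun h' => h.right_border (Or.inr ⟨p, hp, h'⟩)

theorem vertex_left (h : M.NestedRegions A₁ A₂ B₁ B₂) (d : D) (hd : M.edgeOf d ∈ B₁ ∪ B₂) :
    ¬ M.VertexMeets (M.vertexOf d) A₂ :=
  fun h' => h.left_border (Or.inl ⟨_, h', d, rfl, hd⟩)

theorem vertex_right (h : M.NestedRegions A₁ A₂ B₁ B₂) (d : D) (hd : M.edgeOf d ∈ A₁ ∪ A₂) :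
    ¬ M.VertexMeets (M.vertexOf d) B₂ :=
  fun h' => h.right_border (Or.inl ⟨_, h', d, rfl, hd⟩)

end NestedRegions

variable [Fintype D]

/-- The labellings of a region with a prescribed flux through each face. -/
def fluxSet (M : SurfaceMap D) (R : Set M.Edge) (t : M.Face → ZMod 2) : Set (R → ZMod 2) :=
  {a | M.bd (extendZero R a) = t}

/-- A nonempty flux set is a coset of the flux-free labellings. -/
theorem card_fluxSet {R : Set M.Edge} {t : M.Face → ZMod 2} {x : M.Edge → ZMod 2}
    (hx : ∀ i ∉ R, x i = 0) (ht : M.bd x = t) :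
    Nat.card (M.fluxSet R t) = Nat.card (M.fluxSet R 0) := by
  refine Nat.card_congr (Equiv.subtypeEquiv (Equiv.subRight (bitRestrict R x)) fun a => ?_)
  change M.bd _ = _ ↔ M.bd (extendZero R (a - bitRestrict R x)) = _
  rw [map_sub, map_sub, extendZero_restrict_of_support hx, ht, sub_eq_zero]

namespace NestedRegions

variable {A₁ A₂ B₁ B₂ : Set M.Edge}

/-- A plaquette on the boundary of `A` can touch neither `A₂` nor `B₂`, as these do not border the
other side. -/
theorem border_nonempty (h : M.NestedRegions A₁ A₂ B₁ B₂) :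
    {p | M.FaceMeets p A₁ ∧ M.FaceMeets p B₁}.Nonempty := by
  obtain ⟨j, hj⟩ := h.contractible_right.nonempty
  have hc : (A₁ ∪ A₂)ᶜ = B₁ ∪ B₂ := by
    ext i
    have := h.part.cover i
    have := h.part.not₁₃ i
    have := h.part.not₁₄ i
    have := h.part.not₂₃ i
    have := h.part.not₂₄ i
    simp only [Set.mem_compl_iff, Set.mem_union]
    tauto
  obtain ⟨p, h1, h2⟩ := M.exists_border_face h.contractible.nonempty ⟨j, by rw [hc]; exact Or.inr hj⟩
  rw [hc, faceMeets_union] at h2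
  rw [faceMeets_union] at h1
  have := h.face_left (p := p)
  have := h.face_right (p := p)
  exact ⟨p, by tauto, by tauto⟩

theorem border_left_nonempty (h : M.NestedRegions A₁ A₂ B₁ B₂) :
    {p | M.FaceMeets p A₁ ∧ M.FaceMeets p A₂}.Nonempty := by
  obtain ⟨j, hj⟩ := h.contractible_right.nonempty
  obtain ⟨p, h1, d, hd, hd'⟩ := M.exists_border_face h.contractible_left.nonempty
    ⟨j, fun hj' => h.part.not₂₄ j hj' hj⟩
  refine ⟨p, ⟨d, hd, ?_⟩, h1⟩
  rcases h.part.cover (M.edgeOf d) with h2 | h2 | h2 | h2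
  · exact h2
  · exact absurd h2 hd'
  · exact absurd ⟨d, hd, h2⟩ (h.face_left h1).1
  · exact absurd ⟨d, hd, h2⟩ (h.face_left h1).2

theorem border_right_nonempty (h : M.NestedRegions A₁ A₂ B₁ B₂) :
    {p | M.FaceMeets p B₁ ∧ M.FaceMeets p B₂}.Nonempty := by
  obtain ⟨j, hj⟩ := h.contractible_left.nonempty
  obtain ⟨p, h1, d, hd, hd'⟩ := M.exists_border_face h.contractible_right.nonempty
    ⟨j, fun hj' => h.part.not₂₄ j hj hj'⟩
  refine ⟨p, ⟨d, hd, ?_⟩, h1⟩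
  rcases h.part.cover (M.edgeOf d) with h2 | h2 | h2 | h2
  · exact absurd ⟨d, hd, h2⟩ (h.face_right h1).1
  · exact absurd ⟨d, hd, h2⟩ (h.face_right h1).2
  · exact h2
  · exact absurd h2 hd'

/-- Fluxes through the inner and the outer boundary of `A₁` can be prescribed independently. -/
theorem exists_bd_eq_add (h : M.NestedRegions A₁ A₂ B₁ B₂) {t u : M.Face → ZMod 2}
    (ht : ∀ p, ¬ (M.FaceMeets p A₁ ∧ M.FaceMeets p B₁) → t p = 0) (ht' : ∑ p, t p = 0)
    (hu : ∀ p, ¬ (M.FaceMeets p A₁ ∧ M.FaceMeets p A₂) → u p = 0) (hu' : ∑ p, u p = 0) :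
    ∃ x : M.Edge → ZMod 2, (∀ i ∉ A₁, x i = 0) ∧ M.bd x = t + u := by
  obtain ⟨α, hα, hbα⟩ := M.exists_bd_eq h.contractible.connected
    (fun p hp => ht p fun h' => hp (faceMeets_union.2 (Or.inl h'.1))) ht'
  obtain ⟨γ, hγ, hbγ⟩ := M.exists_bd_eq h.contractible_left.connected
    (fun p hp => hu p fun h' => hp h'.2) hu'
  -- `α` realises `t` in all of `A`, and `γ` realises `u` in `A₂`. A gradient makes `α` agree with
  -- `γ` on `A₂` without touching `B`, so adding `γ` leaves a labelling supported in `A₁`.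
  obtain ⟨φ, hφ, hφ0⟩ := M.exists_cob_eq_of_loops h.contractible_left.loops h.vertex_left
    (y := γ + α) fun p hp => by
      rw [map_add, hbα, hbγ, Pi.add_apply, ht, hu, add_zero]
      · rintro ⟨⟨d, hd, hd'⟩, -⟩
        exact h.part.not₁₂ _ hd' (hp d hd)
      · rintro ⟨⟨d, hd, hd'⟩, -⟩
        exact h.part.not₁₂ _ hd' (hp d hd)
  refine ⟨α + M.cob φ + γ, fun i hi => ?_, ?_⟩
  · simp only [Pi.add_apply]
    rcases h.part.cover i with h1 | h1 | h1 | h1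
    · exact absurd h1 hi
    · rw [hφ i h1, Pi.add_apply]
      linear_combination CharTwo.add_self_eq_zero (α i) + CharTwo.add_self_eq_zero (γ i)
    · have h2 : i ∉ A₂ := fun h2 => h.part.not₂₃ i h2 h1
      rw [hφ0 i (Or.inl h1), hα i (by simp [hi, h2]), hγ i h2, add_zero, add_zero]
    · have h2 : i ∉ A₂ := fun h2 => h.part.not₂₄ i h2 h1
      rw [hφ0 i (Or.inr h1), hα i (by simp [hi, h2]), hγ i h2, add_zero, add_zero]
  · rw [map_add, map_add, M.bd_cob, hbα, hbγ, add_zero]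

/-- Labellings of `A` and `B₂` without flux inside these regions extend to a global gradient. -/
theorem exists_cob_eq (h : M.NestedRegions A₁ A₂ B₁ B₂) {α β : M.Edge → ZMod 2}
    (hα : ∀ p, (∀ d, M.faceOf d = p → M.edgeOf d ∈ A₁ ∪ A₂) → M.bd α p = 0)
    (hβ : ∀ p, (∀ d, M.faceOf d = p → M.edgeOf d ∈ B₂) → M.bd β p = 0) :
    ∃ φ, (∀ i ∈ A₁ ∪ A₂, M.cob φ i = α i) ∧ ∀ i ∈ B₂, M.cob φ i = β i := by
  obtain ⟨φ₁, hφ₁, -⟩ := M.exists_cob_eq_of_loops (S := ∅) h.contractible.loops (by simp) hα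
  -- The second gradient corrects the first on `B₂` and vanishes on `A`.
  obtain ⟨φ₂, hφ₂, hφ₂0⟩ := M.exists_cob_eq_of_loops h.contractible_right.loops h.vertex_right
    (y := β + M.cob φ₁) fun p hp => by
      rw [map_add, M.bd_cob, add_zero, hβ p hp]
  refine ⟨φ₁ + φ₂, fun i hi => ?_, fun i hi => ?_⟩
  · rw [map_add, Pi.add_apply, hφ₁ i hi, hφ₂0 i hi, add_zero]
  · rw [map_add, Pi.add_apply, hφ₂ i hi, Pi.add_apply]
    linear_combination CharTwo.add_self_eq_zero (M.cob φ₁ i)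

/-- The nested decomposition of a stabilised state, given an enumeration of the even fluxes through
the three borders. -/
theorem exists_isNestedSum (h : M.NestedRegions A₁ A₂ B₁ B₂) {m n k : ℕ}
    {t : Fin m → M.Face → ZMod 2} {u : Fin n → M.Face → ZMod 2} {w : Fin k → M.Face → ZMod 2}
    (htinj : Function.Injective t)
    (ht : ∀ v, (∃ μ, t μ = v) ↔
      (∀ p ∉ {p | M.FaceMeets p A₁ ∧ M.FaceMeets p B₁}, v p = 0) ∧ ∑ p, v p = 0)
    (huinj : Function.Injective u)
    (hu : ∀ v, (∃ ν, u ν = v) ↔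
      (∀ p ∉ {p | M.FaceMeets p A₁ ∧ M.FaceMeets p A₂}, v p = 0) ∧ ∑ p, v p = 0)
    (hwinj : Function.Injective w)
    (hw : ∀ v, (∃ τ, w τ = v) ↔
      (∀ p ∉ {p | M.FaceMeets p B₁ ∧ M.FaceMeets p B₂}, v p = 0) ∧ ∑ p, v p = 0) :
    Orthonormal ℂ (fun q : Fin m × Fin n => uniformState (M.fluxSet A₁ (t q.1 + u q.2))) ∧
    Orthonormal ℂ (fun ν => uniformState (M.fluxSet A₂ (u ν))) ∧
    Orthonormal ℂ (fun τ => uniformState (M.fluxSet B₂ (w τ))) ∧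
    ∀ ψ : QubitSpace M.Edge, ‖ψ‖ = 1 → M.IsStabilized ψ →
      ∃ f : Fin m → Fin k → QubitSpace B₁,
        Orthonormal ℂ (fun q : Fin m × Fin k => f q.1 q.2) ∧
        IsNestedSum (fun μ ν => uniformState (M.fluxSet A₁ (t μ + u ν)))
          (fun ν => uniformState (M.fluxSet A₂ (u ν))) f
          (fun τ => uniformState (M.fluxSet B₂ (w τ))) ψ := by
  have ht' := fun μ => (ht (t μ)).1 ⟨μ, rfl⟩
  have hu' := fun ν => (hu (u ν)).1 ⟨ν, rfl⟩
  have hw' := fun τ => (hw (w τ)).1 ⟨τ, rfl⟩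
  have hα := fun μ => M.exists_bd_eq h.contractible.connected
    (fun p hp => (ht' μ).1 p fun h' => hp (faceMeets_union.2 (Or.inl h'.1))) (ht' μ).2
  have hγ := fun ν => M.exists_bd_eq h.contractible_left.connected
    (fun p hp => (hu' ν).1 p fun h' => hp h'.2) (hu' ν).2
  have hβ := fun τ => M.exists_bd_eq h.contractible_right.connected
    (fun p hp => (hw' τ).1 p fun h' => hp h'.2) (hw' τ).2
  have hε := fun μ ν => h.exists_bd_eq_add (ht' μ).1 (ht' μ).2 (hu' ν).1 (hu' ν).2
  choose α hα hbα using hα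
  choose γ hγ hbγ using hγ
  choose β hβ hbβ using hβ
  choose ε hε hbε using hε
  have hne : ∀ {R : Set M.Edge} {x : M.Edge → ZMod 2} {v : M.Face → ZMod 2}
      (_ : ∀ i ∉ R, x i = 0) (_ : M.bd x = v), (M.fluxSet R v).Nonempty := by
    intro R x v hx hv
    refine ⟨bitRestrict R x, ?_⟩
    rw [fluxSet, Set.mem_ofPred_eq, extendZero_restrict_of_support hx, hv]
  have hF : ∀ μ ν μ' ν' a, a ∈ M.fluxSet A₁ (t μ + u ν) → a ∈ M.fluxSet A₁ (t μ' + u ν') →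
      μ = μ' ∧ ν = ν' := by
    intro μ ν μ' ν' a h1 h2
    have h3 := eq_of_add_eq_add_of_disjoint_support (fun p hp hp' => (h.face_left hp'.2).1 hp.2)
      (ht' μ).1 (ht' μ').1 (hu' ν).1 (hu' ν').1 (h1.symm.trans h2)
    exact ⟨htinj h3.1, huinj h3.2⟩
  have hG : ∀ ν ν' a, a ∈ M.fluxSet A₂ (u ν) → a ∈ M.fluxSet A₂ (u ν') → ν = ν' :=
    fun ν ν' a h1 h2 => huinj (h1.symm.trans h2)
  have hH : ∀ τ τ' b, b ∈ M.fluxSet B₂ (w τ) → b ∈ M.fluxSet B₂ (w τ') → τ = τ' :=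
    fun τ τ' b h1 h2 => hwinj (h1.symm.trans h2)
  refine ⟨?_, ?_, ?_, fun ψ hψ hs => ?_⟩
  · refine orthonormal_of_disjoint_supports
      (fun q => norm_uniformState (hne (hε q.1 q.2) (hbε q.1 q.2))) fun q q' a h1 h2 => ?_
    have h3 := hF _ _ _ _ a (mem_of_amp_uniformState_ne_zero h1) (mem_of_amp_uniformState_ne_zero h2)
    exact Prod.ext h3.1 h3.2
  · exact orthonormal_of_disjoint_supports (fun ν => norm_uniformState (hne (hγ ν) (hbγ ν)))
      fun ν ν' a h1 h2 => hG _ _ a (mem_of_amp_uniformState_ne_zero h1)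
        (mem_of_amp_uniformState_ne_zero h2)
  · exact orthonormal_of_disjoint_supports (fun τ => norm_uniformState (hne (hβ τ) (hbβ τ)))
      fun τ τ' a h1 h2 => hH _ _ a (mem_of_amp_uniformState_ne_zero h1)
        (mem_of_amp_uniformState_ne_zero h2)
  refine _root_.exists_isNestedSum h.part
    -- The parts of the string in `A` and `B₂` are replaced by reference labellings with fluxes `t
    -- μ` and `w τ`. The label `ν` is absent: the flux of `A` through the border `A₁A₂` is zero.
    (χ := fun μ τ b => amp ψ (α μ + extendZero B₁ b + β τ))
    (K := ∑ b, ‖amp ψ (extendZero B₁ b)‖ ^ 2)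
    (fun μ ν => card_fluxSet (hε μ ν) (hbε μ ν)) (fun ν => card_fluxSet (hγ ν) (hbγ ν))
    (fun τ => card_fluxSet (hβ τ) (hbβ τ)) hF hH ?_ ?_ hψ ?_ ?_
  -- On the support the total flux vanishes, so `b` has flux `t μ + w τ`, which determines both
  -- labels.
  · intro μ τ μ' τ' b h1 h2
    have h1 := hs.bd_eq_zero _ h1
    have h2 := hs.bd_eq_zero _ h2
    rw [map_add, map_add, hbα, hbβ] at h1 h2
    have h3 : t μ + w τ = t μ' + w τ' := by
      have h4 := h1.trans h2.symm
      rw [add_right_comm, add_right_comm (t μ')] at h4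
      exact add_right_cancel h4
    have h5 := eq_of_add_eq_add_of_disjoint_support (fun p hp hp' => (h.face_right hp'.2).1 hp.1)
      (ht' μ).1 (ht' μ').1 (hw' τ).1 (hw' τ').1 h3
    exact ⟨htinj h5.1, hwinj h5.2⟩
  · intro μ τ
    -- Translation by a gradient that equals the references on `A` and `B₂` erases them and permutes
    -- the strings on `B₁`, so the norm is independent of the labels.
    obtain ⟨φ, hφ, hφ'⟩ := h.exists_cob_eq (α := α μ) (β := β τ)
      (fun p hp => by
        rw [hbα]
        refine (ht' μ).1 p ?_
        rintro ⟨-, d, hd, hd'⟩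
        rcases hp d hd with h1 | h1
        exacts [h.part.not₁₃ _ h1 hd', h.part.not₂₃ _ h1 hd'])
      (fun p hp => by
        rw [hbβ]
        refine (hw' τ).1 p ?_
        rintro ⟨⟨d, hd, hd'⟩, -⟩
        exact h.part.not₃₄ _ hd' (hp d hd))
    have key : ∀ b, α μ + extendZero B₁ b + β τ + M.cob φ =
        extendZero B₁ (b + bitRestrict B₁ (M.cob φ)) := by
      intro b
      rw [map_add, extendZero_restrict]
      ext i
      simp only [Pi.add_apply]
      rcases h.part.cover i with h1 | h1 | h1 | h1
      · rw [hφ i (Or.inl h1), hβ τ i (h.part.not₁₄ i h1),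
          Set.indicator_of_notMem (h.part.not₁₃ i h1)]
        linear_combination CharTwo.add_self_eq_zero (α μ i)
      · rw [hφ i (Or.inr h1), hβ τ i (h.part.not₂₄ i h1),
          Set.indicator_of_notMem (h.part.not₂₃ i h1)]
        linear_combination CharTwo.add_self_eq_zero (α μ i)
      · have h2 : i ∉ A₁ ∪ A₂ := by
          rintro (h2 | h2)
          exacts [h.part.not₁₃ i h2 h1, h.part.not₂₃ i h2 h1]
        rw [hα μ i h2, hβ τ i (h.part.not₃₄ i h1), Set.indicator_of_mem h1]
        ring
      · have h2 : i ∉ A₁ ∪ A₂ := by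
          rintro (h2 | h2)
          exacts [h.part.not₁₄ i h2 h1, h.part.not₂₄ i h2 h1]
        rw [hα μ i h2, hφ' i h1, Set.indicator_of_notMem fun h3 => h.part.not₃₄ i h3 h1]
        linear_combination CharTwo.add_self_eq_zero (β τ i)
    refine Fintype.sum_equiv (Equiv.addRight (bitRestrict B₁ (M.cob φ)))
      (fun b => ‖amp ψ (α μ + extendZero B₁ b + β τ)‖ ^ 2)
      (fun b => ‖amp ψ (extendZero B₁ b)‖ ^ 2) fun b => ?_
    rw [Equiv.coe_addRight, ← key, hs.amp_add_cob]
  · intro x μ ν τ h1 h2 h3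
    change M.bd _ = _ at h1 h2 h3
    -- On `A` the string has flux `t μ + u ν + u ν = t μ`, the flux of its reference; the difference
    -- is a gradient and leaves the amplitude unchanged.
    obtain ⟨φ₁, hφ₁⟩ := M.exists_cob_of_dual_loops h.contractible.dual_loops
      (z := α μ + extendZero A₁ (bitRestrict A₁ x) + extendZero A₂ (bitRestrict A₂ x))
      (fun i hi => by
        rw [Pi.add_apply, Pi.add_apply, hα μ i hi, extendZero_apply_of_notMem _ fun h' => hi (Or.inl h'),
          extendZero_apply_of_notMem _ fun h' => hi (Or.inr h'), add_zero, add_zero])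
      (by
        rw [map_add, map_add, hbα, h1, h2, ← add_assoc, add_self_zmod_two, zero_add,
          add_self_zmod_two])
    obtain ⟨φ₂, hφ₂⟩ := M.exists_cob_of_dual_loops h.contractible_right.dual_loops
      (z := β τ + extendZero B₂ (bitRestrict B₂ x))
      (fun i hi => by
        rw [Pi.add_apply, hβ τ i hi, extendZero_apply_of_notMem _ hi, add_zero])
      (by rw [map_add, hbβ, h3, add_self_zmod_two])
    rw [← hs.amp_add_cob x (φ₁ + φ₂), map_add, hφ₁, hφ₂]
    congr 1
    nth_rewrite 1 [h.part.eq_add x]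
    linear_combination add_self_zmod_two (extendZero A₁ (bitRestrict A₁ x)) +
      add_self_zmod_two (extendZero A₂ (bitRestrict A₂ x)) +
      add_self_zmod_two (extendZero B₂ (bitRestrict B₂ x))
  · intro x hx
    have hb := hs.bd_eq_zero x hx
    have hin : ∀ {R : Set M.Edge} {p : M.Face}, (∀ d, M.faceOf d = p → M.edgeOf d ∈ R) →
        M.bd (R.indicator x) p = 0 := by
      intro R p hp
      rw [M.bd_congr (y := x) fun d hd => Set.indicator_of_mem (hp d hd) x, hb, Pi.zero_apply]
    have hout : ∀ {R : Set M.Edge} {p : M.Face}, ¬ M.FaceMeets p R → M.bd (R.indicator x) p = 0 :=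
      fun {R p} hp => M.bd_eq_zero_of_not_faceMeets (fun i hi => Set.indicator_of_notMem hi x) hp
    -- The part of a flux-free string in a region has no flux through plaquettes inside or outside
    -- the region, which leaves only the border.
    obtain ⟨ν, hν⟩ := (hu (M.bd (A₂.indicator x))).2 ⟨fun p hp => by
      by_cases hpA : M.FaceMeets p A₂
      · refine hin fun d hd => ?_
        rcases h.part.cover (M.edgeOf d) with h1 | h1 | h1 | h1
        · exact absurd ⟨⟨d, hd, h1⟩, hpA⟩ hp
        · exact h1
        · exact absurd ⟨d, hd, h1⟩ (h.face_left hpA).1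
        · exact absurd ⟨d, hd, h1⟩ (h.face_left hpA).2
      · exact hout hpA, M.sum_bd _⟩
    obtain ⟨τ, hτ⟩ := (hw (M.bd (B₂.indicator x))).2 ⟨fun p hp => by
      by_cases hpB : M.FaceMeets p B₂
      · refine hin fun d hd => ?_
        rcases h.part.cover (M.edgeOf d) with h1 | h1 | h1 | h1
        · exact absurd ⟨d, hd, h1⟩ (h.face_right hpB).1
        · exact absurd ⟨d, hd, h1⟩ (h.face_right hpB).2
        · exact absurd ⟨⟨d, hd, h1⟩, hpB⟩ hp
        · exact h1
      · exact hout hpB, M.sum_bd _⟩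
    obtain ⟨μ, hμ⟩ := (ht (M.bd ((A₁ ∪ A₂).indicator x))).2 ⟨fun p hp => by
      by_cases hpA : M.FaceMeets p (A₁ ∪ A₂)
      · have hB₂ : ¬ M.FaceMeets p B₂ := fun h' => h.right_border (Or.inr ⟨p, h', hpA⟩)
        rw [faceMeets_union] at hpA
        refine hin fun d hd => ?_
        rcases h.part.cover (M.edgeOf d) with h1 | h1 | h1 | h1
        · exact Or.inl h1
        · exact Or.inr h1
        · have hB₁ : M.FaceMeets p B₁ := ⟨d, hd, h1⟩
          exact absurd ⟨hpA.resolve_right fun h' => (h.face_left h').1 hB₁, hB₁⟩ hp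
        · exact absurd ⟨d, hd, h1⟩ hB₂
      · exact hout hpA, M.sum_bd _⟩
    refine ⟨μ, ν, τ, ?_, ?_, ?_⟩
    · change M.bd _ = _
      -- The flux of the part in `A₁` is that of the part in `A` plus that of the part in `A₂`.
      rw [hμ, hν, extendZero_restrict, Set.indicator_union_of_disjoint
        (Set.disjoint_left.2 h.part.not₁₂)]
      change _ = M.bd (A₁.indicator x + A₂.indicator x) + _
      rw [map_add, add_assoc, add_self_zmod_two, add_zero]
    · change M.bd _ = _
      rw [hν, extendZero_restrict]
    · change M.bd _ = _
      rw [hτ, extendZero_restrict]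

end NestedRegions

end Regions

end SurfaceMap

/-! ### Assembly of the theorem -/

theorem mainTheorem9 {D : Type*} [Fintype D] (M : SurfaceMap D)
    (A₁ A₂ B₁ B₂ : Set M.Edge)
    (hA : Disjoint A₁ A₂) (hB : Disjoint B₁ B₂) (hAB : B₁ ∪ B₂ = (A₁ ∪ A₂)ᶜ)
    (hcA : M.IsContractible (A₁ ∪ A₂))
    (hcA₂ : M.IsContractible A₂) (hcB₂ : M.IsContractible B₂)
    (hA₂B : ¬ M.ShareBorder A₂ (B₁ ∪ B₂)) (hB₂A : ¬ M.ShareBorder B₂ (A₁ ∪ A₂)) :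
    (1 ≤ M.borderCount A₁ B₁ ∧ 1 ≤ M.borderCount A₁ A₂ ∧ 1 ≤ M.borderCount B₁ B₂) ∧
    ∃ (e : Fin (2 ^ (M.borderCount A₁ B₁ - 1)) → Fin (2 ^ (M.borderCount A₁ A₂ - 1)) →
          QubitSpace A₁)
      (g : Fin (2 ^ (M.borderCount A₁ A₂ - 1)) → QubitSpace A₂)
      (h : Fin (2 ^ (M.borderCount B₁ B₂ - 1)) → QubitSpace B₂),
      Orthonormal ℂ (fun p : Fin (2 ^ (M.borderCount A₁ B₁ - 1)) ×
        Fin (2 ^ (M.borderCount A₁ A₂ - 1)) => e p.1 p.2) ∧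
      Orthonormal ℂ g ∧ Orthonormal ℂ h ∧
      (∃ f : Fin (2 ^ (M.borderCount A₁ B₁ - 1)) → Fin (2 ^ (M.borderCount B₁ B₂ - 1)) →
          QubitSpace B₁,
        Orthonormal ℂ (fun p : Fin (2 ^ (M.borderCount A₁ B₁ - 1)) ×
          Fin (2 ^ (M.borderCount B₁ B₂ - 1)) => f p.1 p.2) ∧
        SurfaceMap.IsNestedSum e g f h M.psiZero) ∧
      ∀ U J : ℝ, 0 < U → 0 < J → ∀ ψ : QubitSpace M.Edge, M.IsGroundState U J ψ →
        ∃ f : Fin (2 ^ (M.borderCount A₁ B₁ - 1)) → Fin (2 ^ (M.borderCount B₁ B₂ - 1)) →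
            QubitSpace B₁,
          Orthonormal ℂ (fun p : Fin (2 ^ (M.borderCount A₁ B₁ - 1)) ×
            Fin (2 ^ (M.borderCount B₁ B₂ - 1)) => f p.1 p.2) ∧
          SurfaceMap.IsNestedSum e g f h ψ := by
  have hmem : ∀ i, i ∈ B₁ ∪ B₂ ↔ ¬ i ∈ A₁ ∪ A₂ := fun i => by rw [hAB]; rfl
  have hreg : M.NestedRegions A₁ A₂ B₁ B₂ :=
    { part :=
        { cover := fun i => by
            have := hmem i
            simp only [Set.mem_union] at this
            tauto
          not₁₂ := fun i h h' => Set.disjoint_left.1 hA h h'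
          not₁₃ := fun i h h' => (hmem i).1 (Or.inl h') (Or.inl h)
          not₁₄ := fun i h h' => (hmem i).1 (Or.inr h') (Or.inl h)
          not₂₃ := fun i h h' => (hmem i).1 (Or.inl h') (Or.inr h)
          not₂₄ := fun i h h' => (hmem i).1 (Or.inr h') (Or.inr h)
          not₃₄ := fun i h h' => Set.disjoint_left.1 hB h h' }
      contractible := hcA
      contractible_left := hcA₂
      contractible_right := hcB₂
      left_border := hA₂B
      right_border := hB₂A }
  have hpos : ∀ R S, {p | M.FaceMeets p R ∧ M.FaceMeets p S}.Nonempty → 1 ≤ M.borderCount R S := by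
    intro R S h
    have : Nonempty {p // M.FaceMeets p R ∧ M.FaceMeets p S} := h.to_subtype
    exact Nat.card_pos
  have hcount : ∀ R S, Nat.card {p | M.FaceMeets p R ∧ M.FaceMeets p S} = M.borderCount R S :=
    fun _ _ => rfl
  refine ⟨⟨hpos _ _ hreg.border_nonempty, hpos _ _ hreg.border_left_nonempty,
    hpos _ _ hreg.border_right_nonempty⟩, ?_⟩
  obtain ⟨t, htinj, ht⟩ := exists_enum_even hreg.border_nonempty (hcount A₁ B₁)
  obtain ⟨u, huinj, hu⟩ := exists_enum_even hreg.border_left_nonempty (hcount A₁ A₂)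
  obtain ⟨w, hwinj, hw⟩ := exists_enum_even hreg.border_right_nonempty (hcount B₁ B₂)
  obtain ⟨he, hg, hh, hf⟩ := hreg.exists_isNestedSum htinj ht huinj hu hwinj hw
  -- These families depend only on the regions and the enumerations, so they serve all ground states
  -- at once.
  exact ⟨fun μ ν => uniformState (M.fluxSet A₁ (t μ + u ν)),
    fun ν => uniformState (M.fluxSet A₂ (u ν)), fun τ => uniformState (M.fluxSet B₂ (w τ)),
    he, hg, hh, hf _ M.norm_psiZero M.isStabilized_psiZero,
    fun U J hU hJ ψ hψ => hf ψ hψ.1 (SurfaceMap.IsGroundState.isStabilized M hU hJ hψ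
      M.isStabilized_loopSum M.loopSum_ne_zero)⟩
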